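/- Let $\mathbb F=\mathbb R$ or $\mathbb C$. A Schauder basis $(x_j)_{j\ge1}$ is semi-normalized if $0<\inf_j\|x_j\|\le\sup_j\|x_j\|<\infty$. Let $\mathcal B=(x_n)_{n=1}^\infty$ be a semi-normalized Schauder basis of a Banach space $\mathbb X$ over $\mathbb F$. Let $\mathbb S\subseteq\mathbb F^{\mathbb N}$ be a subsymmetric sequence space, i.e. a Banach space of sequences for which the unit-vector system $(e_j)$ is a Schauder basis (with the coordinates as coordinate functionals) such that $$\Big\|\sum_j\varepsilon_ja_je_{\phi(j)}\Big\|_{\mathbb S}=\Big\|\sum_j a_je_j\Big\|_{\mathbb S}$$ for all $\sum_j a_je_j\in\mathbb S$, all signs $\varepsilon_j\in\{1,-1\}$ and all strictly increasing $\phi:\mathbb N\to\mathbb N$. Put $\Lambda_m=\|\sum_{j=1}^m e_j\|_{\mathbb S}$ and $\Lambda_m^*=m/\Lambda_m$ for $m\ge1$. Let $\sigma=(\sigma_n)_{n=1}^\infty$ be an ordered partition of $\mathbb N$: the $\sigma_n$ are nonempty finite sets with union $\mathbb N$ and $\max\sigma_n<\min\sigma_{n+1}$ for all $n$. Put $M_r=\sum_{n=1}^r|\sigma_n|$,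 and for $f=(a_j)\in c_{00}$ (the space of finitely supported scalar sequences) put $v_n^*(f)=\frac1{\Lambda^*_{|\sigma_n|}}\sum_{j\in\sigma_n}a_j$ and $Q_\sigma f=f-P_\sigma f$, where the $k$-th entry of $P_\sigma f$ is $\frac1{|\sigma_n|}\sum_{j\in\sigma_n}a_j$ if $k\in\sigma_n$. Let $\mathbb Y[\mathcal B,\mathbb S,\sigma]$ be the completion of $c_{00}$ for the norm $$\|f\|_{\mathcal B,\mathbb S,\sigma}=\|Q_\sigma f\|_{\mathbb S}+\Big\|\sum_{n=1}^\infty v_n^*(f)\,x_n\Big\|_{\mathbb X}.$$ Assume that there is a constant $C$ with $M_r\le C\,|\sigma_{r+1}|$ for all $r\ge1$, and that either $\mathbb S=\ell_1$ (with its usual norm), or $(\Lambda_m)_{m=1}^\infty$ has both the lower regularity property (there is an integer $b\ge1$ with $2\Lambda_m\le\Lambda_{bm}$ for all $m\ge1$) and the upper regularity property (there is an integer $b\ge3$ with $\Lambda_{bm}\le\frac b2\Lambda_m$ for all $m\ge1$). Then the unit-vector system is a semi-normalized Schauder basis $(u_j)$ of $\mathbb Y=\mathbb Y[\mathcal B,\mathbb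 S,\sigma]$, with coordinate functionals $(u_j^*)$, and it is almost greedy: writing $S_A f=\sum_{j\in A}u_j^*(f)u_j$, there is a constant $C$ such that $$\|f-S_Ff\|\le C\,\|f-S_Af\|$$ for all $f\in\mathbb Y$ and all finite $A,F\subseteq\mathbb N$ such that $|A|\le|F|$ and $|u_j^*(f)|\le|u_k^*(f)|$ for all $j\notin F$, $k\in F$. Moreover its fundamental function $\varphi_m=\sup_{|A|\le m}\big\|\sum_{j\in A}u_j\big\|$ is equivalent to $(\Lambda_m)$: there are constants $C_1,C_2$ with $\varphi_m\le C_1\Lambda_m$ and $\Lambda_m\le C_2\varphi_m$ for all $m\ge1$. -/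

import Mathlib

noncomputable section

/-! Sequences are indexed by `ℕ = {0, 1, 2, …}`; the zero-based index `j` plays the role of the
one-based index `j + 1`.  Finitely supported scalar sequences (the space `c₀₀`) are elements of
`ℕ →₀ 𝕜`, with unit vectors `Finsupp.single j 1`. -/

/-! ### Bases of Banach spaces -/

namespace SchauderBasis

variable {𝕜 : Type*} [RCLike 𝕜] {X : Type*} [NormedAddCommGroup X] [NormedSpace 𝕜 X]

/-- `0 < inf_j ‖x_j‖ ≤ sup_j ‖x_j‖ < ∞`. -/
def IsSemiNormalized (B : SchauderBasis 𝕜 X) : Prop :=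
  ∃ c C : ℝ, 0 < c ∧ ∀ j, c ≤ ‖B j‖ ∧ ‖B j‖ ≤ C

/-- `F` is a greedy set of `f`: every coefficient of `f` with index in `F` is at least as large
in modulus as every coefficient with index outside `F`. -/
def IsGreedySet (B : SchauderBasis 𝕜 X) (f : X) (F : Finset ℕ) : Prop :=
  ∀ k ∈ F, ∀ j ∉ F, ‖B.coord j f‖ ≤ ‖B.coord k f‖

/-- Almost greedy bases: there is a constant `C` with `‖f - S_F f‖ ≤ C ‖f - S_A f‖` for all `f`,
all finite greedy sets `F` of `f` and all `A` with `|A| ≤ |F|`, where `S_A` is the coordinate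
projection on `A`. -/
def IsAlmostGreedy (B : SchauderBasis 𝕜 X) : Prop :=
  ∃ C : ℝ, ∀ (f : X) (A F : Finset ℕ), A.card ≤ F.card → B.IsGreedySet f F →
    ‖f - GeneralSchauderBasis.proj B F f‖ ≤ C * ‖f - GeneralSchauderBasis.proj B A f‖

/-- The fundamental function `φ_m = sup_{|A| ≤ m} ‖∑_{j ∈ A} x_j‖`. -/
def fundamentalFunction (B : SchauderBasis 𝕜 X) (m : ℕ) : ℝ :=
  ⨆ A : {A : Finset ℕ // A.card ≤ m}, ‖∑ j ∈ A.1, B j‖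

end SchauderBasis

/-! ### Weights -/

/-- `α_m ≲ β_m` for `m = 1, 2, …`. -/
def WeightLesssim (α β : ℕ → ℝ) : Prop := ∃ C : ℝ, ∀ m, 1 ≤ m → α m ≤ C * β m

/-- Equivalence of `(α_m)_{m ≥ 1}` and `(β_m)_{m ≥ 1}`. -/
def WeightEquiv (α β : ℕ → ℝ) : Prop := WeightLesssim α β ∧ WeightLesssim β α

/-- The lower regularity property of `(l_m)_{m ≥ 1}`. -/
def HasLRP (l : ℕ → ℝ) : Prop := ∃ b : ℕ, 1 ≤ b ∧ ∀ m, 1 ≤ m → 2 * l m ≤ l (b * m)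

/-- The upper regularity property of `(l_m)_{m ≥ 1}`. -/
def HasURP (l : ℕ → ℝ) : Prop :=
  ∃ b : ℕ, 3 ≤ b ∧ ∀ m, 1 ≤ m → l (b * m) ≤ ((b : ℝ) / 2) * l m

/-! ### Subsymmetric sequence spaces -/

/-- The structure of a subsymmetric sequence space on a Banach space `S`: an identification `coord`
of `S` with a linear space of scalar sequences, for which the unit-vector system is a Schauder
basis (with the coordinates as coordinate functionals) that is `1`-subsymmetric. The last property
is stated for finite sums, from which it passes to all convergent series, and only for the signs
`1` and `-1`, also when the scalars are complex. -/
structure SubsymmetricSequenceSpace (𝕜 S : Type*) [RCLike 𝕜]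
    [NormedAddCommGroup S] [NormedSpace 𝕜 S] where
  /-- the sequence of coordinates of a vector -/
  coord : S →ₗ[𝕜] (ℕ → 𝕜)
  coord_injective : Function.Injective coord
  /-- the unit-vector system -/
  e : SchauderBasis 𝕜 S
  coord_e : ∀ j, coord (e j) = Pi.single j 1
  e_coord : ∀ j f, e.coord j f = coord f j
  subsymmetric : ∀ (n : ℕ) (a ε : ℕ → 𝕜) (φ : ℕ → ℕ), (∀ j, ε j = 1 ∨ ε j = -1) → StrictMono φ →
    ‖∑ j ∈ Finset.range n, (ε j * a j) • e (φ j)‖ = ‖∑ j ∈ Finset.range n, a j • e j‖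

namespace SubsymmetricSequenceSpace

variable {𝕜 S : Type*} [RCLike 𝕜] [NormedAddCommGroup S] [NormedSpace 𝕜 S]

/-- `Λ_m = ‖e_1 + ⋯ + e_m‖`. -/
def fund (E : SubsymmetricSequenceSpace 𝕜 S) (m : ℕ) : ℝ := ‖∑ j ∈ Finset.range m, E.e j‖

/-- `Λ*_m = m / Λ_m`. -/
def dualFund (E : SubsymmetricSequenceSpace 𝕜 S) (m : ℕ) : ℝ := m / E.fund m

/-- The element of `S` given by a finitely supported sequence. -/
def ofFinsupp (E : SubsymmetricSequenceSpace 𝕜 S) : (ℕ →₀ 𝕜) →ₗ[𝕜] S :=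
  Finsupp.linearCombination 𝕜 E.e

theorem coord_ofFinsupp (E : SubsymmetricSequenceSpace 𝕜 S) (f : ℕ →₀ 𝕜) :
    E.coord (E.ofFinsupp f) = f := by
  classical
  ext k
  simp only [ofFinsupp, Finsupp.linearCombination_apply, Finsupp.sum, map_sum, map_smul,
    E.coord_e, Finset.sum_apply, Pi.smul_apply, Pi.single_apply, smul_eq_mul, mul_ite, mul_one,
    mul_zero, Finset.sum_ite_eq, Finsupp.mem_support_iff]
  by_cases h : f k = 0 <;> simp [h]

/-- The sequence space is `ℓ₁`: its elements are the absolutely summable sequences, with norm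
`∑ |a_j|`. -/
def IsEllOne (E : SubsymmetricSequenceSpace 𝕜 S) : Prop :=
  (∀ a : ℕ → 𝕜, a ∈ Set.range E.coord ↔ Summable fun j => ‖a j‖) ∧
    ∀ f : S, ‖f‖ = ∑' j, ‖E.coord f j‖

end SubsymmetricSequenceSpace

/-! ### Ordered partitions and averaging projections -/

/-- `Av(f, A) = |A|⁻¹ ∑_{j ∈ A} a_j`. -/
def seqAverage {𝕜 : Type*} [RCLike 𝕜] (f : ℕ → 𝕜) (A : Finset ℕ) : 𝕜 :=
  (A.card : 𝕜)⁻¹ * ∑ j ∈ A, f j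

/-- An ordered partition of `ℕ`: nonempty finite sets with union `ℕ` and
`max σ_n < min σ_{n+1}` for all `n`. -/
structure OrderedPartition where
  block : ℕ → Finset ℕ
  nonempty : ∀ n, (block n).Nonempty
  ordered : ∀ n, (block n).max' (nonempty n) < (block (n + 1)).min' (nonempty (n + 1))
  cover : ∀ j, ∃ n, j ∈ block n

namespace OrderedPartition

variable (σ : OrderedPartition)

theorem lt_of_lt {m n : ℕ} (h : m < n) : ∀ i ∈ σ.block m, ∀ j ∈ σ.block n, i < j := by
  induction n, h using Nat.le_induction with
  | base =>
    intro i hi j hj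
    exact ((Finset.le_max' _ i hi).trans_lt (σ.ordered m)).trans_le (Finset.min'_le _ j hj)
  | succ n _ ih =>
    intro i hi j hj
    obtain ⟨k, hk⟩ := σ.nonempty n
    exact (ih i hi k hk).trans
      (((Finset.le_max' _ k hk).trans_lt (σ.ordered n)).trans_le (Finset.min'_le _ j hj))

theorem eq_of_mem {m n j : ℕ} (hm : j ∈ σ.block m) (hn : j ∈ σ.block n) : m = n := by
  rcases lt_trichotomy m n with h | h | h
  · exact absurd (σ.lt_of_lt h j hm j hn) (lt_irrefl j)
  · exact h
  · exact absurd (σ.lt_of_lt h j hn j hm) (lt_irrefl j)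

/-- The index of the block that contains `j`. -/
def index (j : ℕ) : ℕ := (σ.cover j).choose

theorem mem_block_index (j : ℕ) : j ∈ σ.block (σ.index j) := (σ.cover j).choose_spec

theorem index_eq {j n : ℕ} (h : j ∈ σ.block n) : σ.index j = n :=
  σ.eq_of_mem (σ.mem_block_index j) h

/-- `M_r`, the number of elements of the first `r` blocks. -/
def partialCard (r : ℕ) : ℕ := ∑ n ∈ Finset.range r, (σ.block n).card

/-- The condition `M_r ≲ |σ_{r+1}|`, `r = 1, 2, …` (in the zero-based numbering the first `r`
blocks are those with numbers `0, …, r - 1`, and the next one has number `r`). -/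
def LacunaryGrowth : Prop :=
  ∃ C : ℝ, ∀ r, 1 ≤ r → (σ.partialCard r : ℝ) ≤ C * ((σ.block r).card : ℝ)

variable {𝕜 : Type*} [RCLike 𝕜]

theorem sum_block_eq_zero (f : ℕ →₀ 𝕜) {n : ℕ} (h : n ∉ f.support.image σ.index) :
    ∑ j ∈ σ.block n, f j = 0 := by
  classical
  refine Finset.sum_eq_zero fun j hj => ?_
  by_contra hne
  exact h (Finset.mem_image.2 ⟨j, Finsupp.mem_support_iff.2 hne, σ.index_eq hj⟩)

theorem averaging_finite_support (f : ℕ →₀ 𝕜) :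
    (Function.support fun k => seqAverage f (σ.block (σ.index k))).Finite := by
  classical
  refine ((f.support.image σ.index).biUnion σ.block).finite_toSet.subset fun k hk => ?_
  rw [Finset.mem_coe, Finset.mem_biUnion]
  refine ⟨σ.index k, ?_, σ.mem_block_index k⟩
  by_contra hne
  exact hk (by simp [seqAverage, σ.sum_block_eq_zero f hne])

/-- The averaging projection `P_σ` on `c₀₀`: the `k`-th entry of `P_σ f` is `Av(f, σ_n)`, where
`σ_n` is the block that contains `k`. -/
def averaging : (ℕ →₀ 𝕜) →ₗ[𝕜] (ℕ →₀ 𝕜) where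
  toFun f := Finsupp.ofSupportFinite (fun k => seqAverage f (σ.block (σ.index k)))
    (σ.averaging_finite_support f)
  map_add' f g := by
    ext k
    simp [Finsupp.ofSupportFinite_coe, seqAverage, Finset.sum_add_distrib, mul_add]
  map_smul' c f := by
    ext k
    simp only [Finsupp.ofSupportFinite_coe, seqAverage, Finsupp.smul_apply, smul_eq_mul,
      RingHom.id_apply, ← Finset.mul_sum]
    ring

/-- The complementary projection `Q_σ = Id - P_σ` on `c₀₀`. -/
def coAveraging : (ℕ →₀ 𝕜) →ₗ[𝕜] (ℕ →₀ 𝕜) := LinearMap.id - σ.averaging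

end OrderedPartition

/-! ### The Dilworth–Kalton–Kutzarova method -/

section DKK

variable {𝕜 X S : Type*} [RCLike 𝕜] [NormedAddCommGroup X] [NormedSpace 𝕜 X]
  [NormedAddCommGroup S] [NormedSpace 𝕜 S]

/-- The functional `v_n^* = (Λ*_{|σ_n|})⁻¹ ∑_{j ∈ σ_n} e_j^*` on `c₀₀`. -/
def dkkFunctional (E : SubsymmetricSequenceSpace 𝕜 S) (σ : OrderedPartition) (n : ℕ)
    (f : ℕ →₀ 𝕜) : 𝕜 :=
  ((E.dualFund (σ.block n).card : ℝ) : 𝕜)⁻¹ * ∑ j ∈ σ.block n, f j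

theorem dkkFunctional_finite_support (E : SubsymmetricSequenceSpace 𝕜 S) (σ : OrderedPartition)
    (x : ℕ → X) (f : ℕ →₀ 𝕜) :
    (Function.support fun n => dkkFunctional E σ n f • x n).Finite := by
  classical
  refine (f.support.image σ.index).finite_toSet.subset fun n hn => ?_
  by_contra hne
  exact hn (by simp [dkkFunctional, σ.sum_block_eq_zero f hne])

/-- The linear map `f ↦ ∑_n v_n^*(f) x_n` from `c₀₀` to `X` (a finite sum for each `f`). -/
def dkkSynthesis (B : SchauderBasis 𝕜 X) (E : SubsymmetricSequenceSpace 𝕜 S)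
    (σ : OrderedPartition) : (ℕ →₀ 𝕜) →ₗ[𝕜] X where
  toFun f := ∑ᶠ n, dkkFunctional E σ n f • B n
  map_add' f g := by
    rw [← finsum_add_distrib (dkkFunctional_finite_support E σ B f)
      (dkkFunctional_finite_support E σ B g)]
    refine finsum_congr fun n => ?_
    simp [dkkFunctional, Finset.sum_add_distrib, mul_add, add_smul]
  map_smul' c f := by
    rw [RingHom.id_apply, smul_finsum' c (dkkFunctional_finite_support E σ B f)]
    refine finsum_congr fun n => ?_
    simp only [dkkFunctional, Finsupp.smul_apply, smul_eq_mul, ← Finset.mul_sum, smul_smul]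
    congr 1
    ring

/-- The space `c₀₀`, to be endowed with the norm `‖·‖_{B,S,σ}`. -/
def DKKPreSpace (_B : SchauderBasis 𝕜 X) (_E : SubsymmetricSequenceSpace 𝕜 S)
    (_σ : OrderedPartition) : Type _ := ℕ →₀ 𝕜

variable (B : SchauderBasis 𝕜 X) (E : SubsymmetricSequenceSpace 𝕜 S) (σ : OrderedPartition)

instance : AddCommGroup (DKKPreSpace B E σ) := inferInstanceAs (AddCommGroup (ℕ →₀ 𝕜))

instance : Module 𝕜 (DKKPreSpace B E σ) := inferInstanceAs (Module 𝕜 (ℕ →₀ 𝕜))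

/-- The linear identification of `c₀₀` with the space `DKKPreSpace B E σ`. -/
def DKKPreSpace.of : (ℕ →₀ 𝕜) ≃ₗ[𝕜] DKKPreSpace B E σ := LinearEquiv.refl 𝕜 (ℕ →₀ 𝕜)

/-- The gauge `‖f‖_{B,S,σ} = ‖Q_σ f‖_S + ‖∑_n v_n^*(f) x_n‖_X`. -/
instance : Norm (DKKPreSpace B E σ) where
  norm f := ‖E.ofFinsupp (σ.coAveraging ((DKKPreSpace.of B E σ).symm f))‖ +
    ‖dkkSynthesis B E σ ((DKKPreSpace.of B E σ).symm f)‖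

theorem DKKPreSpace.norm_def (f : DKKPreSpace B E σ) :
    ‖f‖ = ‖E.ofFinsupp (σ.coAveraging ((DKKPreSpace.of B E σ).symm f))‖ +
      ‖dkkSynthesis B E σ ((DKKPreSpace.of B E σ).symm f)‖ := rfl

theorem DKKPreSpace.core : SeminormedSpace.Core 𝕜 (DKKPreSpace B E σ) where
  norm_nonneg f := by rw [DKKPreSpace.norm_def]; positivity
  norm_smul c f := by
    simp only [DKKPreSpace.norm_def, map_smul, norm_smul]
    ring
  norm_triangle f g := by
    simp only [DKKPreSpace.norm_def, map_add]
    have h₁ := norm_add_le (E.ofFinsupp (σ.coAveraging ((DKKPreSpace.of B E σ).symm f)))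
      (E.ofFinsupp (σ.coAveraging ((DKKPreSpace.of B E σ).symm g)))
    have h₂ := norm_add_le (dkkSynthesis B E σ ((DKKPreSpace.of B E σ).symm f))
      (dkkSynthesis B E σ ((DKKPreSpace.of B E σ).symm g))
    linarith

instance : SeminormedAddCommGroup (DKKPreSpace B E σ) :=
  SeminormedAddCommGroup.ofCore (DKKPreSpace.core B E σ)

instance : NormedSpace 𝕜 (DKKPreSpace B E σ) where
  norm_smul_le c f := ((DKKPreSpace.core B E σ).norm_smul c f).le

/-- The Banach space `Y[B, S, σ]`, the completion of `(c₀₀, ‖·‖_{B,S,σ})`. (Once the unit vectors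
are known to be a semi-normalized Schauder basis of it, their coordinate functionals identify it
with a space of null sequences, which is the completion carried out inside `c₀`.) -/
abbrev DKKSpace : Type _ := UniformSpace.Completion (DKKPreSpace B E σ)

/-- The unit-vector system of `Y[B, S, σ]`. -/
def DKKSpace.unitVector (j : ℕ) : DKKSpace B E σ :=
  ((DKKPreSpace.of B E σ (Finsupp.single j 1) : DKKPreSpace B E σ) : DKKSpace B E σ)

end DKK

end

/-!
Write `Λ_m` for the fundamental function of `S`, `M_r` for the number of elements of the first `r`
blocks, and `N` for the norm of `S` on `c₀₀`. The proof works on `c₀₀` with the norm `dkkNorm` and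
passes to the completion at the end.

In `S`, real multipliers bounded by `1` are contractive, so `N` is a lattice norm up to the factor
`2` (the scalars may be complex), and a sum of shifts shows that
`Λ_{|A|} ∑_{j ∈ A} |f_j| ≤ 4 |A| N(f)` (`fund_mul_sum_norm_le`); in particular `Λ_m / m` is almost
decreasing. Lacunarity makes the sizes of the blocks grow geometrically, and comparable to `M_r`.
Hence the lower regularity property, which `ℓ₁` also has, makes `Λ_{|σ_n|}` geometrically increasing,
and the upper one makes `Λ_{|σ_n|} / |σ_n|` geometrically decreasing.

Almost greediness rests on three estimates in `Y`.

* If `|f| ≤ s` and `f` is supported in `A`, then `‖f‖ ≤ C s Λ_{|A|}`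
  (`exists_dkkNorm_le_of_bound`): `‖f‖` is dominated by `N(f)` and `∑_n |v_n^*(f)|`, and the
  latter is split into blocks smaller and larger than `A`.
* If `|f| ≥ t` on `F`, then `t Λ_{|F|} ≤ C ‖f‖` (`exists_mul_fund_le_dkkNorm`): on `F` one of
  `Q_σ f` and `P_σ f` has modulus at least `t / 2`, and `P_σ f` is bounded by a multiple of
  `‖f‖ / Λ_{|σ_n|}` on the block `σ_n`.
* If `F` is a greedy set of `f`, then `‖S_F f‖ ≤ C ‖f‖` (`exists_dkkNorm_seqRestrict_greedy_le`).
  Choose `N` with `M_N ≤ |F| ≤ M_{N+1}`. On the first `N` blocks, the projection onto their union is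
  bounded because `B` is a basis, and what has to be removed from it is controlled by the first two
  estimates. On the remaining blocks, geometric decay bounds all the `|v_n^*(S_F f)|` together; for
  `ℓ₁`, where the upper regularity property fails, the part coming from `Q_σ f` is bounded by the
  norm of `ℓ₁` directly.

With `g = f - S_A f` the identity `f - S_F f = (g - S_{F \ A} g) + S_{A \ F} f` then gives the almost
greedy inequality, and the first two estimates with `s = t = 1` identify the fundamental function.
The same ingredients bound the coordinates and the partial sums, which therefore extend to the
completion; partial sums of a vector inherit its greedy sets, so the almost greedy inequality
extends as well.
-/

noncomputable section

/-! ### Finitely supported sequences -/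

section FinitelySupported

variable {𝕜 : Type*} [RCLike 𝕜]

/-- The coordinate projection `S_A` on `c₀₀`. -/
def seqRestrict (A : Finset ℕ) : (ℕ →₀ 𝕜) →ₗ[𝕜] (ℕ →₀ 𝕜) where
  toFun f := f.filter (· ∈ A)
  map_add' _ _ := Finsupp.filter_add
  map_smul' _ _ := Finsupp.filter_smul

theorem seqRestrict_apply (A : Finset ℕ) (f : ℕ →₀ 𝕜) (k : ℕ) :
    seqRestrict A f k = if k ∈ A then f k else 0 :=
  Finsupp.filter_apply _ _ _

theorem seqRestrict_support_subset (A : Finset ℕ) (f : ℕ →₀ 𝕜) :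
    (seqRestrict A f).support ⊆ A := by
  intro k hk
  by_contra h
  exact Finsupp.mem_support_iff.1 hk (by rw [seqRestrict_apply, if_neg h])

theorem sum_seqRestrict (A s : Finset ℕ) (f : ℕ →₀ 𝕜) :
    ∑ j ∈ s, seqRestrict A f j = ∑ j ∈ A ∩ s, f j := by
  simp only [seqRestrict_apply, ← Finset.sum_filter]
  rw [Finset.filter_mem_eq_inter, Finset.inter_comm]

/-- The indicator sequence of a finite set. -/
def seqOnes (𝕜 : Type*) [RCLike 𝕜] (A : Finset ℕ) : ℕ →₀ 𝕜 := Finsupp.indicator A fun _ _ => 1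

theorem seqOnes_apply (A : Finset ℕ) (k : ℕ) : seqOnes 𝕜 A k = if k ∈ A then 1 else 0 := by
  simp [seqOnes, Finsupp.indicator_apply]

theorem seqOnes_support_subset (A : Finset ℕ) : (seqOnes 𝕜 A).support ⊆ A :=
  Finsupp.support_indicator_subset _ _

/-- Every finite set of naturals is the image of an initial segment under a strictly increasing
map of `ℕ`. -/
theorem Finset.exists_strictMono_image_range (A : Finset ℕ) :
    ∃ φ : ℕ → ℕ, StrictMono φ ∧ A = (Finset.range A.card).image φ := by
  induction A using Finset.induction_on_max with
  | empty => exact ⟨id, strictMono_id, by simp⟩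
  | insert x s hs ih =>
    obtain ⟨φ, hφ, hA⟩ := ih
    have hx : x ∉ s := fun h => lt_irrefl _ (hs x h)
    have hlt : ∀ i < s.card, φ i < x := fun i hi =>
      hs _ (by rw [hA]; exact Finset.mem_image_of_mem _ (Finset.mem_range.2 hi))
    refine ⟨fun i => if i < s.card then φ i else x + (i - s.card), ?_, ?_⟩
    · intro i j hij
      dsimp only
      split_ifs with h1 h2
      · exact hφ hij
      · exact (hlt i h1).trans_le (Nat.le_add_right _ _)
      · omega
      · omega
    · rw [Finset.card_insert_of_notMem hx, Finset.range_add_one, Finset.image_insert]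
      simp only [lt_irrefl, if_false, Nat.sub_self, Nat.add_zero]
      congr 1
      conv_lhs => rw [hA]
      refine Finset.image_congr fun i hi => ?_
      simp only [Finset.coe_range, Set.mem_Iio] at hi
      simp [hi]

end FinitelySupported

/-! ### Norm estimates in subsymmetric sequence spaces -/

namespace SubsymmetricSequenceSpace

variable {𝕜 S : Type*} [RCLike 𝕜] [NormedAddCommGroup S] [NormedSpace 𝕜 S]
  (E : SubsymmetricSequenceSpace 𝕜 S)

theorem ofFinsupp_eq_sum {f : ℕ →₀ 𝕜} {A : Finset ℕ} (h : f.support ⊆ A) :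
    E.ofFinsupp f = ∑ j ∈ A, f j • E.e j := by
  rw [ofFinsupp, Finsupp.linearCombination_apply]
  exact Finsupp.sum_of_support_subset _ h _ (by simp)

theorem ofFinsupp_single (j : ℕ) (a : 𝕜) : E.ofFinsupp (Finsupp.single j a) = a • E.e j := by
  simp [ofFinsupp]

theorem ofFinsupp_seqOnes (A : Finset ℕ) : E.ofFinsupp (seqOnes 𝕜 A) = ∑ j ∈ A, E.e j := by
  rw [E.ofFinsupp_eq_sum (seqOnes_support_subset A)]
  exact Finset.sum_congr rfl fun j hj => by simp [seqOnes_apply, hj]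

/-- The norm of a finite sum depends only on its successive coefficients. -/
theorem norm_sum_strictMono (n : ℕ) (a : ℕ → 𝕜) {φ : ℕ → ℕ} (hφ : StrictMono φ) :
    ‖∑ j ∈ Finset.range n, a j • E.e (φ j)‖ = ‖∑ j ∈ Finset.range n, a j • E.e j‖ := by
  simpa using E.subsymmetric n a (fun _ => 1) φ (fun _ => Or.inl rfl) hφ

theorem norm_sum_e (A : Finset ℕ) : ‖∑ j ∈ A, E.e j‖ = E.fund A.card := by
  obtain ⟨φ, hφ, hA⟩ := A.exists_strictMono_image_range
  conv_lhs => rw [hA]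
  rw [Finset.sum_image fun _ _ _ _ h => hφ.injective h]
  simpa [fund] using E.norm_sum_strictMono A.card (fun _ => 1) hφ

theorem norm_ofFinsupp_seqOnes (A : Finset ℕ) : ‖E.ofFinsupp (seqOnes 𝕜 A)‖ = E.fund A.card := by
  rw [ofFinsupp_seqOnes, norm_sum_e]

/-- Multipliers with values in `[-1, 1]` are contractive: by convexity it suffices to consider
multipliers with values `1` and `-1`. -/
theorem norm_sum_real_mul_le (n : ℕ) (a : ℕ → 𝕜) (c : ℕ → ℝ) (hc : ∀ j, |c j| ≤ 1) :
    ‖∑ j ∈ Finset.range n, ((c j : 𝕜) * a j) • E.e j‖ ≤ ‖∑ j ∈ Finset.range n, a j • E.e j‖ := by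
  classical
  suffices H : ∀ (T : Finset ℕ) (c : ℕ → ℝ), (∀ j, |c j| ≤ 1) →
      (∀ j ∈ Finset.range n, j ∉ T → c j = 1 ∨ c j = -1) →
      ‖∑ j ∈ Finset.range n, ((c j : 𝕜) * a j) • E.e j‖
        ≤ ‖∑ j ∈ Finset.range n, a j • E.e j‖ from
    H (Finset.range n) c hc fun j hj hj' => absurd hj hj'
  intro T
  induction T using Finset.induction_on with
  | empty =>
    intro c _ h
    have := E.subsymmetric n a (fun j => if j < n then (c j : 𝕜) else 1) id (fun j => by
      by_cases hj : j < n
      · rcases h j (Finset.mem_range.2 hj) (by simp) with h | h <;> simp [hj, h]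
      · simp [hj]) strictMono_id
    rw [← this]
    refine le_of_eq (congrArg _ (Finset.sum_congr rfl fun j hj => ?_))
    simp [Finset.mem_range.1 hj]
  | insert i T hi ih =>
    intro c hc h
    -- The two values `s = 1, -1` at the index `i` are the ends of a segment through `c`.
    have key : ∀ s : ℝ, (s = 1 ∨ s = -1) →
        ‖∑ j ∈ Finset.range n, ((Function.update c i s j : 𝕜) * a j) • E.e j‖
          ≤ ‖∑ j ∈ Finset.range n, a j • E.e j‖ := by
      intro s hs
      refine ih _ (fun j => ?_) fun j hj hjT => ?_
      · by_cases hji : j = i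
        · subst hji
          rcases hs with rfl | rfl <;> simp
        · simpa [hji] using hc j
      · by_cases hji : j = i
        · subst hji
          simpa using hs
        · simpa [hji] using h j hj (by simp [hji, hjT])
    have hsplit : ∑ j ∈ Finset.range n, ((c j : 𝕜) * a j) • E.e j =
        (((1 + c i) / 2 : ℝ) : 𝕜) •
          ∑ j ∈ Finset.range n, ((Function.update c i 1 j : 𝕜) * a j) • E.e j +
        (((1 - c i) / 2 : ℝ) : 𝕜) •
          ∑ j ∈ Finset.range n, ((Function.update c i (-1) j : 𝕜) * a j) • E.e j := by
      rw [Finset.smul_sum, Finset.smul_sum, ← Finset.sum_add_distrib]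
      refine Finset.sum_congr rfl fun j _ => ?_
      rw [smul_smul, smul_smul, ← add_smul]
      congr 1
      by_cases hji : j = i
      · subst hji
        push_cast [Function.update_self]
        ring
      · simp only [Function.update_of_ne hji]
        push_cast
        ring
    have hci := abs_le.1 (hc i)
    have h1 : 0 ≤ (1 + c i) / 2 := by linarith
    have h2 : 0 ≤ (1 - c i) / 2 := by linarith
    rw [hsplit]
    refine (norm_add_le _ _).trans ?_
    rw [norm_smul, norm_smul, RCLike.norm_ofReal, RCLike.norm_ofReal, abs_of_nonneg h1,
      abs_of_nonneg h2]
    have := mul_le_mul_of_nonneg_left (key 1 (Or.inl rfl)) h1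
    have := mul_le_mul_of_nonneg_left (key (-1) (Or.inr rfl)) h2
    linarith

theorem norm_ofFinsupp_le_of_real_mul {f g : ℕ →₀ 𝕜} (c : ℕ → ℝ) (hc : ∀ j, |c j| ≤ 1)
    (h : ∀ j, g j = (c j : 𝕜) * f j) : ‖E.ofFinsupp g‖ ≤ ‖E.ofFinsupp f‖ := by
  obtain ⟨n, hn⟩ := f.support.exists_nat_subset_range
  have hg : g.support ⊆ Finset.range n := fun j hj => hn (by
    rw [Finsupp.mem_support_iff] at hj ⊢
    exact fun h0 => hj (by rw [h, h0, mul_zero]))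
  rw [E.ofFinsupp_eq_sum hn, E.ofFinsupp_eq_sum hg]
  simpa only [h] using E.norm_sum_real_mul_le n f c hc

theorem norm_ofFinsupp_seqRestrict_le (A : Finset ℕ) (f : ℕ →₀ 𝕜) :
    ‖E.ofFinsupp (seqRestrict A f)‖ ≤ ‖E.ofFinsupp f‖ := by
  refine E.norm_ofFinsupp_le_of_real_mul (fun j => if j ∈ A then 1 else 0) (fun j => ?_)
    fun j => ?_
  · split_ifs <;> simp
  · rw [seqRestrict_apply]
    split_ifs <;> simp

/-- The norm is a lattice norm up to the factor `2`, which comes from splitting complex multipliers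
into real and imaginary parts. -/
theorem norm_ofFinsupp_le_of_norm_le {f g : ℕ →₀ 𝕜} (h : ∀ j, ‖g j‖ ≤ ‖f j‖) :
    ‖E.ofFinsupp g‖ ≤ 2 * ‖E.ofFinsupp f‖ := by
  set c : ℕ → 𝕜 := fun j => g j / f j with hc_def
  have hc : ∀ j, ‖c j‖ ≤ 1 := fun j => by
    rw [hc_def, norm_div]
    exact div_le_one_of_le₀ (h j) (norm_nonneg _)
  have hgc : ∀ j, g j = c j * f j := fun j => by
    by_cases h0 : f j = 0
    · have := h j
      rw [h0, norm_zero] at this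
      rw [h0, mul_zero]
      exact norm_le_zero_iff.1 this
    · rw [hc_def, div_mul_cancel₀ _ h0]
  obtain ⟨n, hn⟩ := f.support.exists_nat_subset_range
  have hg : g.support ⊆ Finset.range n := fun j hj => hn (by
    rw [Finsupp.mem_support_iff] at hj ⊢
    exact fun h0 => hj (by rw [hgc, h0, mul_zero]))
  have hsplit : ∑ j ∈ Finset.range n, g j • E.e j =
      ∑ j ∈ Finset.range n, (((RCLike.re (c j) : ℝ) : 𝕜) * f j) • E.e j +
        (RCLike.I : 𝕜) • ∑ j ∈ Finset.range n, (((RCLike.im (c j) : ℝ) : 𝕜) * f j) • E.e j := by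
    rw [Finset.smul_sum, ← Finset.sum_add_distrib]
    refine Finset.sum_congr rfl fun j _ => ?_
    rw [smul_smul, ← add_smul]
    congr 1
    rw [hgc j]
    conv_lhs => rw [← RCLike.re_add_im (c j)]
    ring
  have hI : ‖(RCLike.I : 𝕜)‖ ≤ 1 := by
    rcases eq_or_ne (RCLike.I : 𝕜) 0 with h0 | h0
    · simp [h0]
    · exact (RCLike.norm_I_of_ne_zero h0).le
  rw [E.ofFinsupp_eq_sum hn, E.ofFinsupp_eq_sum hg, hsplit]
  refine (norm_add_le _ _).trans ?_
  rw [norm_smul]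
  have h1 := E.norm_sum_real_mul_le n f (fun j => RCLike.re (c j))
    fun j => (RCLike.abs_re_le_norm _).trans (hc j)
  have h2 := E.norm_sum_real_mul_le n f (fun j => RCLike.im (c j))
    fun j => (RCLike.abs_im_le_norm _).trans (hc j)
  have h3 := mul_le_mul hI h2 (norm_nonneg _) zero_le_one
  linarith

theorem fund_nonneg (m : ℕ) : 0 ≤ E.fund m := norm_nonneg _

theorem fund_mono : Monotone E.fund := by
  intro m n h
  have := E.norm_ofFinsupp_seqRestrict_le (Finset.range m) (seqOnes 𝕜 (Finset.range n))
  have hr : seqRestrict (Finset.range m) (seqOnes 𝕜 (Finset.range n)) =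
      seqOnes 𝕜 (Finset.range m) := by
    ext k
    simp only [seqRestrict_apply, seqOnes_apply, Finset.mem_range]
    split_ifs <;> first | rfl | omega
  rw [hr, norm_ofFinsupp_seqOnes, norm_ofFinsupp_seqOnes] at this
  simpa using this

theorem fund_pos {m : ℕ} (h : 1 ≤ m) : 0 < E.fund m := by
  refine lt_of_lt_of_le ?_ (E.fund_mono h)
  rw [fund, Finset.sum_range_one, norm_pos_iff]
  intro h0
  have := E.e.ortho 0 0
  rw [h0] at this
  simp at this

@[simp]
theorem fund_zero : E.fund 0 = 0 := by simp [fund]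

theorem fund_add_le (m n : ℕ) : E.fund (m + n) ≤ E.fund m + E.fund n := by
  rw [fund, Finset.sum_range_add]
  refine (norm_add_le _ _).trans (add_le_add le_rfl (le_of_eq ?_))
  simpa [fund] using E.norm_sum_strictMono n (fun _ => 1) (φ := fun j => m + j)
    fun i j h => Nat.add_lt_add_left h m

theorem fund_mul_le (k m : ℕ) : E.fund (k * m) ≤ k * E.fund m := by
  induction k with
  | zero => simp
  | succ k ih =>
    rw [Nat.succ_mul]
    refine (E.fund_add_le _ _).trans ?_
    push_cast
    linarith

/-- The estimate behind the boundedness of averaging projections: in the sum of `2 m` successive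
shifts of `(a_0, …, a_{m-1})` the entries with indices in `[m, 2 m)` are all equal to
`a_0 + ⋯ + a_{m-1}`. -/
theorem fund_mul_norm_sum_range_le (m : ℕ) (a : ℕ → 𝕜) :
    E.fund m * ‖∑ i ∈ Finset.range m, a i‖ ≤
      2 * m * ‖∑ i ∈ Finset.range m, a i • E.e i‖ := by
  classical
  set g : ℕ →₀ 𝕜 := ∑ k ∈ Finset.range (2 * m), ∑ i ∈ Finset.range m,
    Finsupp.single (k + i) (a i) with hg
  have h1 : ‖E.ofFinsupp g‖ ≤ 2 * m * ‖∑ i ∈ Finset.range m, a i • E.e i‖ := by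
    rw [hg, map_sum]
    refine (norm_sum_le _ _).trans ?_
    have : ∀ k ∈ Finset.range (2 * m),
        ‖E.ofFinsupp (∑ i ∈ Finset.range m, Finsupp.single (k + i) (a i))‖ =
          ‖∑ i ∈ Finset.range m, a i • E.e i‖ := fun k _ => by
      simp only [map_sum, ofFinsupp_single]
      exact E.norm_sum_strictMono m a (φ := fun i => k + i) fun i j h => Nat.add_lt_add_left h k
    rw [Finset.sum_congr rfl this]
    simp
  have h2 : seqRestrict (Finset.Ico m (2 * m)) g =
      (∑ i ∈ Finset.range m, a i) • seqOnes 𝕜 (Finset.Ico m (2 * m)) := by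
    ext l
    rw [seqRestrict_apply, Finsupp.smul_apply, seqOnes_apply]
    split_ifs with hl
    · rw [Finset.mem_Ico] at hl
      rw [smul_eq_mul, mul_one, hg, Finset.sum_comm, Finsupp.finsetSum_apply]
      refine Finset.sum_congr rfl fun i hi => ?_
      have hi' := Finset.mem_range.1 hi
      rw [Finsupp.finsetSum_apply, Finset.sum_eq_single (l - i)]
      · rw [Nat.sub_add_cancel (by omega), Finsupp.single_eq_same]
      · intro k _ hk
        exact Finsupp.single_eq_of_ne (by omega)
      · intro h
        exact absurd (Finset.mem_range.2 (by omega)) h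
    · simp
  have h3 := E.norm_ofFinsupp_seqRestrict_le (Finset.Ico m (2 * m)) g
  rw [h2, map_smul, norm_smul, norm_ofFinsupp_seqOnes, Nat.card_Ico,
    show 2 * m - m = m by omega] at h3
  linarith [mul_comm (E.fund m) ‖∑ i ∈ Finset.range m, a i‖]

/-- The shift estimate for an arbitrary finite set `A`. -/
theorem fund_mul_norm_sum_le (A : Finset ℕ) (f : ℕ →₀ 𝕜) :
    E.fund A.card * ‖∑ j ∈ A, f j‖ ≤ 2 * A.card * ‖E.ofFinsupp f‖ := by
  obtain ⟨φ, hφ, hA⟩ := A.exists_strictMono_image_range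
  have hinj : Set.InjOn φ (Finset.range A.card) := hφ.injective.injOn
  have h1 := E.fund_mul_norm_sum_range_le A.card fun i => f (φ i)
  rw [← E.norm_sum_strictMono A.card _ hφ] at h1
  have e1 : ∑ i ∈ Finset.range A.card, f (φ i) = ∑ j ∈ A, f j := by
    conv_rhs => rw [hA]
    rw [Finset.sum_image hinj]
  have e2 : ∑ i ∈ Finset.range A.card, f (φ i) • E.e (φ i) = E.ofFinsupp (seqRestrict A f) := by
    rw [E.ofFinsupp_eq_sum (seqRestrict_support_subset A f)]
    conv_rhs => enter [1]; rw [hA]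
    rw [Finset.sum_image hinj]
    refine Finset.sum_congr rfl fun i hi => ?_
    rw [seqRestrict_apply, if_pos (by rw [hA]; exact Finset.mem_image_of_mem _ hi)]
  rw [e1, e2] at h1
  refine h1.trans ?_
  exact mul_le_mul_of_nonneg_left (E.norm_ofFinsupp_seqRestrict_le A f)
    (mul_nonneg zero_le_two (Nat.cast_nonneg _))

/-- The dual norm of the indicator of `A` is at most `4 |A| / Λ_{|A|}`. -/
theorem fund_mul_sum_norm_le (A : Finset ℕ) (f : ℕ →₀ 𝕜) :
    E.fund A.card * ∑ j ∈ A, ‖f j‖ ≤ 4 * A.card * ‖E.ofFinsupp f‖ := by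
  set g : ℕ →₀ 𝕜 := f.mapRange (fun z => ((‖z‖ : ℝ) : 𝕜)) (by simp) with hg
  have h1 := E.fund_mul_norm_sum_le A g
  have h2 : ‖E.ofFinsupp g‖ ≤ 2 * ‖E.ofFinsupp f‖ :=
    E.norm_ofFinsupp_le_of_norm_le fun j => by simp [hg]
  have h3 : ‖∑ j ∈ A, g j‖ = ∑ j ∈ A, ‖f j‖ := by
    simp only [hg, Finsupp.mapRange_apply, ← RCLike.ofReal_sum]
    rw [RCLike.norm_ofReal, abs_of_nonneg (Finset.sum_nonneg fun _ _ => norm_nonneg _)]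
  rw [h3] at h1
  have h4 : 2 * (A.card : ℝ) * ‖E.ofFinsupp g‖ ≤ 2 * A.card * (2 * ‖E.ofFinsupp f‖) := by gcongr
  linarith

/-- `Λ_m / m` is decreasing up to the factor `2`. -/
theorem fund_mul_le_mul_fund {m n : ℕ} (h : m ≤ n) : E.fund n * m ≤ 2 * n * E.fund m := by
  have h1 := E.fund_mul_norm_sum_le (Finset.range n) (seqOnes 𝕜 (Finset.range m))
  have h2 : ∑ j ∈ Finset.range n, seqOnes 𝕜 (Finset.range m) j = (m : 𝕜) := by
    simp only [seqOnes_apply, ← Finset.sum_filter]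
    rw [Finset.filter_mem_eq_inter, Finset.inter_eq_right.2 (Finset.range_mono h)]
    simp
  rw [h2, norm_ofFinsupp_seqOnes, Finset.card_range, Finset.card_range] at h1
  simpa using h1

theorem norm_ofFinsupp_le_of_bound {f : ℕ →₀ 𝕜} {A : Finset ℕ} {s : ℝ} (hs : 0 ≤ s)
    (hA : f.support ⊆ A) (hf : ∀ j ∈ A, ‖f j‖ ≤ s) : ‖E.ofFinsupp f‖ ≤ 2 * s * E.fund A.card := by
  have h := E.norm_ofFinsupp_le_of_norm_le (f := (s : 𝕜) • seqOnes 𝕜 A) (g := f) fun j => by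
    rw [Finsupp.smul_apply, seqOnes_apply]
    split_ifs with hj
    · simpa [abs_of_nonneg hs] using hf j hj
    · have : f j = 0 := by
        by_contra h0
        exact hj (hA (Finsupp.mem_support_iff.2 h0))
      simp [this]
  rw [map_smul, norm_smul, norm_ofFinsupp_seqOnes, RCLike.norm_ofReal, abs_of_nonneg hs] at h
  linarith

theorem mul_fund_le_of_le_norm {f : ℕ →₀ 𝕜} {A : Finset ℕ} {t : ℝ} (ht : 0 ≤ t)
    (hf : ∀ j ∈ A, t ≤ ‖f j‖) : t * E.fund A.card ≤ 2 * ‖E.ofFinsupp f‖ := by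
  have h := E.norm_ofFinsupp_le_of_norm_le (f := f) (g := (t : 𝕜) • seqOnes 𝕜 A) fun j => by
    rw [Finsupp.smul_apply, seqOnes_apply]
    split_ifs with hj
    · simpa [abs_of_nonneg ht] using hf j hj
    · simp
  rwa [map_smul, norm_smul, norm_ofFinsupp_seqOnes, RCLike.norm_ofReal, abs_of_nonneg ht] at h

theorem IsEllOne.norm_ofFinsupp {E : SubsymmetricSequenceSpace 𝕜 S} (h : E.IsEllOne)
    {f : ℕ →₀ 𝕜} {A : Finset ℕ} (hA : f.support ⊆ A) : ‖E.ofFinsupp f‖ = ∑ j ∈ A, ‖f j‖ := by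
  rw [h.2, E.coord_ofFinsupp]
  refine tsum_eq_sum fun j hj => ?_
  rw [norm_eq_zero]
  by_contra h0
  exact hj (hA (Finsupp.mem_support_iff.2 h0))

theorem IsEllOne.fund_eq {E : SubsymmetricSequenceSpace 𝕜 S} (h : E.IsEllOne) (m : ℕ) :
    E.fund m = m := by
  have h1 := h.norm_ofFinsupp (seqOnes_support_subset (𝕜 := 𝕜) (Finset.range m))
  rw [norm_ofFinsupp_seqOnes, Finset.card_range] at h1
  rw [h1, Finset.sum_congr rfl fun j hj => by rw [seqOnes_apply, if_pos hj]]
  simp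

theorem IsEllOne.hasLRP {E : SubsymmetricSequenceSpace 𝕜 S} (h : E.IsEllOne) : HasLRP E.fund :=
  ⟨2, by norm_num, fun m _ => by rw [h.fund_eq, h.fund_eq]; push_cast; exact le_rfl⟩

end SubsymmetricSequenceSpace

/-! ### Sums of geometrically growing or decaying sequences -/

/-- Tail sums of an almost decreasing sequence that halves after every `p` steps are dominated by
their first term. -/
theorem sum_le_of_halving {s : ℕ → ℝ} {p : ℕ} {D : ℝ} (hp : 1 ≤ p) (hs : ∀ n, 0 ≤ s n)
    (hD : ∀ m n, m ≤ n → s n ≤ D * s m) (h : ∀ n, s (n + p) ≤ s n / 2) {R : Finset ℕ} {N : ℕ}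
    (hR : ∀ n ∈ R, N ≤ n) : ∑ n ∈ R, s n ≤ 2 * p * D * s N := by
  have short : ∀ L ≤ p, ∀ N, ∑ i ∈ Finset.range L, s (N + i) ≤ p * (D * s N) := by
    intro L hL N
    refine (Finset.sum_le_card_nsmul _ _ (D * s N) fun i _ => hD _ _ (by omega)).trans ?_
    rw [Finset.card_range, nsmul_eq_mul]
    have h0 : 0 ≤ D * s N := (hs N).trans (hD N N le_rfl)
    gcongr
  have main : ∀ L N, ∑ i ∈ Finset.range L, s (N + i) ≤ 2 * (p * (D * s N)) := by
    intro L
    induction L using Nat.strong_induction_on with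
    | _ L ih =>
      intro N
      have hDN : 0 ≤ p * (D * s N) :=
        mul_nonneg (Nat.cast_nonneg _) ((hs N).trans (hD N N le_rfl))
      rcases le_or_gt L p with hL | hL
      · linarith [short L hL N]
      · obtain ⟨L', rfl⟩ := Nat.exists_eq_add_of_le hL.le
        rw [Finset.sum_range_add]
        have h1 := short p le_rfl N
        have h2 := ih L' (by omega) (N + p)
        simp only [add_assoc] at h2 ⊢
        have hD0 : 0 ≤ D ∨ s N = 0 := by
          rcases (hs N).eq_or_lt with h0 | h0
          · exact Or.inr h0.symm
          · have := hD N N le_rfl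
            exact Or.inl (by nlinarith)
        have h3 : D * s (N + p) ≤ D * s N / 2 := by
          rcases hD0 with h0 | h0
          · have := mul_le_mul_of_nonneg_left (h N) h0
            linarith
          · have h4 := h N
            have h5 := hs (N + p)
            rw [h0] at h4 ⊢
            rw [show s (N + p) = 0 by linarith]
            simp
        have h4 : (p : ℝ) * (D * s (N + p)) ≤ p * (D * s N / 2) := by gcongr
        linarith
  obtain ⟨L, hL⟩ := R.exists_nat_subset_range
  have hsub : R ⊆ (Finset.range L).image (N + ·) := fun n hn => by
    refine Finset.mem_image.2 ⟨n - N, ?_, ?_⟩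
    · have := Finset.mem_range.1 (hL hn)
      exact Finset.mem_range.2 (by omega)
    · have := hR n hn
      omega
  refine (Finset.sum_le_sum_of_subset_of_nonneg hsub fun n _ _ => hs n).trans ?_
  rw [Finset.sum_image fun _ _ _ _ h => Nat.add_left_cancel h]
  linarith [main L N]

/-- Partial sums of an increasing sequence that doubles after every `p` steps are dominated by
their last term. -/
theorem sum_le_of_doubling {s : ℕ → ℝ} {p : ℕ} (hs : ∀ n, 0 ≤ s n)
    (hmono : Monotone s) (h : ∀ n, 2 * s n ≤ s (n + p)) {R : Finset ℕ} {N : ℕ}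
    (hR : ∀ n ∈ R, n ≤ N) : ∑ n ∈ R, s n ≤ 2 * p * s N := by
  -- For `p = 0` the doubling hypothesis forces `s = 0`.
  have hp : 1 ≤ p ∨ ∀ n, s n = 0 := by
    rcases Nat.eq_zero_or_pos p with rfl | hp
    · refine Or.inr fun n => ?_
      have h1 := h n
      have h2 := hs n
      rw [add_zero] at h1
      linarith
    · exact Or.inl hp
  rcases hp with hp | h0
  swap
  · simp [h0]
  have main : ∀ N, ∑ i ∈ Finset.range (N + 1), s i ≤ 2 * (p * s N) := by
    intro N
    induction N using Nat.strong_induction_on with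
    | _ N ih =>
      have h0 : 0 ≤ p * s N := mul_nonneg (Nat.cast_nonneg _) (hs N)
      rcases lt_or_ge N p with hN | hN
      · have := Finset.sum_le_card_nsmul (Finset.range (N + 1)) s (s N)
          fun i hi => hmono (Nat.lt_succ_iff.1 (Finset.mem_range.1 hi))
        rw [Finset.card_range, nsmul_eq_mul] at this
        have h1 : ((N + 1 : ℕ) : ℝ) ≤ p := by exact_mod_cast hN
        have h2 := mul_le_mul_of_nonneg_right h1 (hs N)
        linarith
      · obtain ⟨M, rfl⟩ := Nat.exists_eq_add_of_le' hN
        rw [show M + p + 1 = (M + 1) + p by ring, Finset.sum_range_add]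
        have h1 := ih M (by omega)
        have h2 := Finset.sum_le_card_nsmul (Finset.range p) (fun i => s (M + 1 + i)) (s (M + p))
          fun i hi => hmono (by have := Finset.mem_range.1 hi; omega)
        rw [Finset.card_range, nsmul_eq_mul] at h2
        have h3 := mul_le_mul_of_nonneg_left (h M) (Nat.cast_nonneg (α := ℝ) p)
        linarith
  refine (Finset.sum_le_sum_of_subset_of_nonneg (t := Finset.range (N + 1)) (fun n hn =>
    Finset.mem_range.2 (Nat.lt_succ_iff.2 (hR n hn))) fun n _ _ => hs n).trans ?_
  linarith [main N]

/-! ### Growth of the blocks of a lacunary partition -/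

namespace OrderedPartition

variable (σ : OrderedPartition)

theorem one_le_card_block (n : ℕ) : 1 ≤ (σ.block n).card := Finset.card_pos.2 (σ.nonempty n)

theorem partialCard_succ (n : ℕ) :
    σ.partialCard (n + 1) = σ.partialCard n + (σ.block n).card :=
  Finset.sum_range_succ _ _

theorem card_block_le_partialCard (n : ℕ) : (σ.block n).card ≤ σ.partialCard (n + 1) := by
  rw [partialCard_succ]
  exact Nat.le_add_left _ _

theorem one_le_partialCard_succ (n : ℕ) : 1 ≤ σ.partialCard (n + 1) :=
  (σ.one_le_card_block n).trans (σ.card_block_le_partialCard n)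

theorem partialCard_mono : Monotone σ.partialCard :=
  monotone_nat_of_le_succ fun n => by rw [partialCard_succ]; exact Nat.le_add_right _ _

theorem le_partialCard (n : ℕ) : n ≤ σ.partialCard n := by
  induction n with
  | zero => exact Nat.zero_le _
  | succ n ih =>
    rw [partialCard_succ]
    have := σ.one_le_card_block n
    omega

variable {σ}

/-- The numbers `|σ_n|` and `M_{n+1}` (in the zero-based numbering of the blocks) are
equivalent. -/
theorem LacunaryGrowth.exists_partialCard_le (h : σ.LacunaryGrowth) :
    ∃ K : ℕ, 1 ≤ K ∧ ∀ n, σ.partialCard (n + 1) ≤ K * (σ.block n).card := by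
  obtain ⟨C, hC⟩ := h
  obtain ⟨k, hk⟩ := exists_nat_ge C
  refine ⟨k + 1, by omega, fun n => ?_⟩
  rw [partialCard_succ, add_mul, one_mul]
  rcases Nat.eq_zero_or_pos n with rfl | hn
  · simp [partialCard]
  · have h1 : (σ.partialCard n : ℝ) ≤ k * (σ.block n).card :=
      (hC n hn).trans (mul_le_mul_of_nonneg_right hk (Nat.cast_nonneg _))
    have h2 : σ.partialCard n ≤ k * (σ.block n).card := by exact_mod_cast h1
    omega

/-- The partial cardinalities `M_1, M_2, …` grow at least geometrically. -/
theorem LacunaryGrowth.exists_mul_partialCard_le (h : σ.LacunaryGrowth) (b : ℕ) :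
    ∃ p : ℕ, 1 ≤ p ∧ ∀ n, b * σ.partialCard (n + 1) ≤ σ.partialCard (n + p + 1) := by
  obtain ⟨K, hK, hT⟩ := h.exists_partialCard_le
  have hK0 : (0 : ℝ) < K := by exact_mod_cast hK
  set r : ℝ := 1 - 1 / K with hr
  have hr0 : 0 ≤ r := by
    rw [hr, sub_nonneg, div_le_one hK0]
    exact_mod_cast hK
  have hr1 : r < 1 := by
    rw [hr]
    linarith [one_div_pos.2 hK0]
  have step : ∀ n, (σ.partialCard (n + 1) : ℝ) ≤ r * σ.partialCard (n + 2) := by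
    intro n
    have h1 : (σ.partialCard (n + 2) : ℝ) ≤ K * (σ.block (n + 1)).card := by
      exact_mod_cast hT (n + 1)
    have h2 : (σ.partialCard (n + 2) : ℝ) = σ.partialCard (n + 1) + (σ.block (n + 1)).card := by
      exact_mod_cast σ.partialCard_succ (n + 1)
    have h3 : (σ.partialCard (n + 2) : ℝ) / K ≤ (σ.block (n + 1)).card := by
      rw [div_le_iff₀ hK0]
      linarith
    have h4 : r * σ.partialCard (n + 2) =
        σ.partialCard (n + 2) - (σ.partialCard (n + 2) : ℝ) / K := by
      rw [hr]
      ring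
    linarith
  have steps : ∀ p n, (σ.partialCard (n + 1) : ℝ) ≤ r ^ p * σ.partialCard (n + p + 1) := by
    intro p
    induction p with
    | zero => intro n; simp
    | succ p ih =>
      intro n
      refine (ih n).trans ?_
      rw [pow_succ, mul_assoc]
      exact mul_le_mul_of_nonneg_left (step (n + p)) (pow_nonneg hr0 p)
  obtain ⟨p, hp⟩ := exists_pow_lt_of_lt_one (show (0 : ℝ) < 1 / (b + 1) by positivity) hr1
  refine ⟨p + 1, by omega, fun n => ?_⟩
  have h1 : (b : ℝ) * r ^ p ≤ 1 := by
    have : (0 : ℝ) < (b : ℝ) + 1 := by positivity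
    rw [lt_div_iff₀ this] at hp
    nlinarith [pow_nonneg hr0 p]
  have h2 : (b : ℝ) * σ.partialCard (n + 1) ≤ σ.partialCard (n + p + 1) := by
    calc (b : ℝ) * σ.partialCard (n + 1)
        ≤ b * (r ^ p * σ.partialCard (n + p + 1)) := by gcongr; exact steps p n
      _ = (b * r ^ p) * σ.partialCard (n + p + 1) := by ring
      _ ≤ 1 * σ.partialCard (n + p + 1) := by gcongr
      _ = _ := one_mul _
  have h3 : b * σ.partialCard (n + 1) ≤ σ.partialCard (n + p + 1) := by exact_mod_cast h2
  exact h3.trans (σ.partialCard_mono (by omega))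

end OrderedPartition

/-! ### Sums of the fundamental function along the blocks -/

namespace SubsymmetricSequenceSpace

variable {𝕜 S : Type*} [RCLike 𝕜] [NormedAddCommGroup S] [NormedSpace 𝕜 S]
  (E : SubsymmetricSequenceSpace 𝕜 S) {σ : OrderedPartition}

/-- By the lower regularity property `Λ_{|σ_n|}` grows geometrically. -/
theorem exists_sum_fund_block_le (hσ : σ.LacunaryGrowth) (hE : HasLRP E.fund) :
    ∃ C : ℝ, 0 ≤ C ∧ ∀ (m : ℕ) (R : Finset ℕ), (∀ n ∈ R, (σ.block n).card ≤ m) →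
      ∑ n ∈ R, E.fund (σ.block n).card ≤ C * E.fund m := by
  obtain ⟨b, hb, hL⟩ := hE
  obtain ⟨K, hK, hT⟩ := hσ.exists_partialCard_le
  obtain ⟨p, hp, hg⟩ := hσ.exists_mul_partialCard_le b
  refine ⟨2 * p * K, by positivity, fun m R hR => ?_⟩
  rcases R.eq_empty_or_nonempty with rfl | hne
  · simp only [Finset.sum_empty]
    exact mul_nonneg (by positivity) (E.fund_nonneg m)
  set N := R.max' hne with hN
  have h1 : ∑ n ∈ R, E.fund (σ.partialCard (n + 1)) ≤
      2 * p * E.fund (σ.partialCard (N + 1)) := by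
    refine sum_le_of_doubling (s := fun n => E.fund (σ.partialCard (n + 1)))
      (fun n => E.fund_nonneg _)
      (fun i j hij => E.fund_mono (σ.partialCard_mono (by omega))) (fun n => ?_)
      fun n hn => R.le_max' n hn
    exact (hL _ (σ.one_le_partialCard_succ n)).trans (E.fund_mono (hg n))
  have h2 : E.fund (σ.partialCard (N + 1)) ≤ K * E.fund m :=
    (E.fund_mono ((hT N).trans (Nat.mul_le_mul_left K (hR N (R.max'_mem hne))))).trans
      (E.fund_mul_le K m)
  calc ∑ n ∈ R, E.fund (σ.block n).card
      ≤ ∑ n ∈ R, E.fund (σ.partialCard (n + 1)) :=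
        Finset.sum_le_sum fun n _ => E.fund_mono (σ.card_block_le_partialCard n)
    _ ≤ 2 * p * E.fund (σ.partialCard (N + 1)) := h1
    _ ≤ 2 * p * (K * E.fund m) := by gcongr
    _ = 2 * p * K * E.fund m := by ring

/-- By the lower regularity property `1 / Λ_{|σ_n|}` decays geometrically. -/
theorem exists_sum_fund_div_fund_block_le (hσ : σ.LacunaryGrowth) (hE : HasLRP E.fund) :
    ∃ C : ℝ, 0 ≤ C ∧ ∀ (m N : ℕ) (R : Finset ℕ), m ≤ σ.partialCard (N + 1) →
      (∀ n ∈ R, N ≤ n) → ∑ n ∈ R, E.fund m / E.fund (σ.block n).card ≤ C := by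
  obtain ⟨b, hb, hL⟩ := hE
  obtain ⟨K, hK, hT⟩ := hσ.exists_partialCard_le
  obtain ⟨p, hp, hg⟩ := hσ.exists_mul_partialCard_le b
  refine ⟨K * (2 * p), by positivity, fun m N R hm hR => ?_⟩
  have hTpos : ∀ n, 0 < E.fund (σ.partialCard (n + 1)) := fun n =>
    E.fund_pos (σ.one_le_partialCard_succ n)
  have h1 : ∑ n ∈ R, 1 / E.fund (σ.partialCard (n + 1)) ≤
      2 * p * 1 * (1 / E.fund (σ.partialCard (N + 1))) := by
    refine sum_le_of_halving (s := fun n => 1 / E.fund (σ.partialCard (n + 1))) hp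
      (fun n => (one_div_pos.2 (hTpos n)).le) (fun i j hij => ?_) (fun n => ?_) hR
    · rw [one_mul]
      exact one_div_le_one_div_of_le (hTpos i) (E.fund_mono (σ.partialCard_mono (by omega)))
    · have h2 := (hL _ (σ.one_le_partialCard_succ n)).trans (E.fund_mono (hg n))
      rw [div_div, mul_comm]
      exact one_div_le_one_div_of_le (by linarith [hTpos n]) h2
  have h2 : ∀ n ∈ R, E.fund m / E.fund (σ.block n).card ≤
      E.fund m * (K * (1 / E.fund (σ.partialCard (n + 1)))) := fun n _ => by
    have h3 := (E.fund_mono (hT n)).trans (E.fund_mul_le K (σ.block n).card)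
    have h4 : 0 < E.fund (σ.block n).card := E.fund_pos (σ.one_le_card_block n)
    rw [div_eq_mul_one_div]
    refine mul_le_mul_of_nonneg_left ?_ (E.fund_nonneg m)
    rw [mul_one_div, div_le_div_iff₀ h4 (hTpos n), one_mul]
    exact h3
  refine (Finset.sum_le_sum h2).trans ?_
  rw [← Finset.mul_sum, ← Finset.mul_sum]
  calc E.fund m * (K * ∑ n ∈ R, 1 / E.fund (σ.partialCard (n + 1)))
      ≤ E.fund m * (K * (2 * p * 1 * (1 / E.fund (σ.partialCard (N + 1))))) := by
        have := E.fund_nonneg m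
        gcongr
    _ = K * (2 * p) * (E.fund m / E.fund (σ.partialCard (N + 1))) := by ring
    _ ≤ K * (2 * p) * 1 := by
        have := div_le_one_of_le₀ (E.fund_mono hm) (hTpos N).le
        gcongr
    _ = _ := mul_one _

/-- By the upper regularity property `Λ_{|σ_n|} / |σ_n|` decays geometrically. -/
theorem exists_sum_fund_block_div_card_le (hσ : σ.LacunaryGrowth) (hE : HasURP E.fund) :
    ∃ C : ℝ, 0 ≤ C ∧ ∀ (m N : ℕ) (R : Finset ℕ), 1 ≤ m → m ≤ σ.partialCard (N + 1) →
      (∀ n ∈ R, N ≤ n) →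
      ∑ n ∈ R, E.fund (σ.block n).card / (σ.block n).card ≤ C * (E.fund m / m) := by
  obtain ⟨b, hb, hU⟩ := hE
  obtain ⟨K, hK, hT⟩ := hσ.exists_partialCard_le
  -- Two applications of the upper regularity property gain a factor `4`, which absorbs the factor
  -- `2` in the almost monotonicity of `Λ_m / m`.
  obtain ⟨p, hp, hg⟩ := hσ.exists_mul_partialCard_le (b * b)
  refine ⟨K * (2 * p * 2) * 2, by positivity, fun m N R hm1 hm hR => ?_⟩
  have quasi : ∀ i j : ℕ, 1 ≤ i → i ≤ j → E.fund j / j ≤ 2 * (E.fund i / i) := by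
    intro i j hi hij
    have hi0 : (0 : ℝ) < i := by exact_mod_cast hi
    have hj0 : (0 : ℝ) < j := by exact_mod_cast hi.trans hij
    rw [← mul_div_assoc, div_le_div_iff₀ hj0 hi0]
    linarith [E.fund_mul_le_mul_fund hij]
  have hTpos : ∀ n, (0 : ℝ) < σ.partialCard (n + 1) := fun n => by
    exact_mod_cast σ.one_le_partialCard_succ n
  have h1 : ∑ n ∈ R, E.fund (σ.partialCard (n + 1)) / σ.partialCard (n + 1) ≤
      2 * p * 2 * (E.fund (σ.partialCard (N + 1)) / σ.partialCard (N + 1)) := by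
    refine sum_le_of_halving
      (s := fun n => E.fund (σ.partialCard (n + 1)) / σ.partialCard (n + 1)) hp
      (fun n => div_nonneg (E.fund_nonneg _) (hTpos n).le)
      (fun i j hij => quasi _ _ (σ.one_le_partialCard_succ i) (σ.partialCard_mono (by omega)))
      (fun n => ?_) hR
    have hT1 := σ.one_le_partialCard_succ n
    have hb1 : 1 ≤ b * σ.partialCard (n + 1) := Nat.mul_pos (by omega) hT1
    have h2 := quasi _ _ (by rw [mul_assoc]; exact Nat.mul_pos (by omega) hb1) (hg n)
    have h3 : E.fund (b * b * σ.partialCard (n + 1)) ≤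
        (b : ℝ) / 2 * ((b : ℝ) / 2 * E.fund (σ.partialCard (n + 1))) := by
      rw [mul_assoc]
      exact (hU _ hb1).trans (mul_le_mul_of_nonneg_left (hU _ hT1) (by positivity))
    have hb0 : (0 : ℝ) < b := by exact_mod_cast (show 0 < b by omega)
    refine h2.trans ?_
    have h4 : E.fund (b * b * σ.partialCard (n + 1)) /
        ((b * b * σ.partialCard (n + 1) : ℕ) : ℝ) ≤
        (b : ℝ) / 2 * ((b : ℝ) / 2 * E.fund (σ.partialCard (n + 1))) /
          ((b * b * σ.partialCard (n + 1) : ℕ) : ℝ) := by gcongr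
    have h5 : (b : ℝ) / 2 * ((b : ℝ) / 2 * E.fund (σ.partialCard (n + 1))) /
          ((b * b * σ.partialCard (n + 1) : ℕ) : ℝ) =
        E.fund (σ.partialCard (n + 1)) / σ.partialCard (n + 1) / 4 := by
      have := (hTpos n).ne'
      push_cast
      field_simp
      ring
    linarith
  have h2 : ∀ n ∈ R, E.fund (σ.block n).card / (σ.block n).card ≤
      K * (E.fund (σ.partialCard (n + 1)) / σ.partialCard (n + 1)) := fun n _ => by
    have h3 : (σ.partialCard (n + 1) : ℝ) ≤ K * (σ.block n).card := by exact_mod_cast hT n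
    have h4 : (0 : ℝ) < (σ.block n).card := by exact_mod_cast σ.one_le_card_block n
    have h5 := E.fund_mono (σ.card_block_le_partialCard n)
    rw [← mul_div_assoc, div_le_div_iff₀ h4 (hTpos n)]
    calc E.fund (σ.block n).card * σ.partialCard (n + 1)
        ≤ E.fund (σ.partialCard (n + 1)) * (K * (σ.block n).card) :=
          mul_le_mul h5 h3 (hTpos n).le (E.fund_nonneg _)
      _ = _ := by ring
  refine (Finset.sum_le_sum h2).trans ?_
  rw [← Finset.mul_sum]
  calc K * ∑ n ∈ R, E.fund (σ.partialCard (n + 1)) / σ.partialCard (n + 1)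
      ≤ K * (2 * p * 2 * (2 * (E.fund m / m))) := by
        refine mul_le_mul_of_nonneg_left (h1.trans ?_) (Nat.cast_nonneg _)
        exact mul_le_mul_of_nonneg_left (quasi _ _ hm1 hm) (by positivity)
    _ = _ := by ring

end SubsymmetricSequenceSpace

/-! ### Averaging, block functionals and synthesis on finitely supported sequences -/

namespace OrderedPartition

variable (σ : OrderedPartition)

/-- The union of the first `N` blocks. -/
def initial (N : ℕ) : Finset ℕ := (Finset.range N).biUnion σ.block

theorem mem_block_iff {j n : ℕ} : j ∈ σ.block n ↔ σ.index j = n :=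
  ⟨σ.index_eq, fun h => h ▸ σ.mem_block_index j⟩

theorem mem_initial {j N : ℕ} : j ∈ σ.initial N ↔ σ.index j < N := by
  simp only [initial, Finset.mem_biUnion, Finset.mem_range, mem_block_iff]
  exact ⟨fun ⟨n, hn, h⟩ => h ▸ hn, fun h => ⟨_, h, rfl⟩⟩

theorem disjoint_block {m n : ℕ} (h : m ≠ n) : Disjoint (σ.block m) (σ.block n) :=
  Finset.disjoint_left.2 fun _ hm hn => h (σ.eq_of_mem hm hn)

theorem card_initial (N : ℕ) : (σ.initial N).card = σ.partialCard N :=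
  Finset.card_biUnion fun _ _ _ _ h => σ.disjoint_block h

theorem index_mono : Monotone σ.index := by
  intro i j hij
  by_contra h
  exact absurd (σ.lt_of_lt (not_le.1 h) j (σ.mem_block_index j) i (σ.mem_block_index i))
    (not_lt.2 hij)

theorem sum_sum_inter_block_le (A R : Finset ℕ) {x : ℕ → ℝ} (hx : ∀ j, 0 ≤ x j) :
    ∑ n ∈ R, ∑ j ∈ A ∩ σ.block n, x j ≤ ∑ j ∈ A, x j := by
  rw [← Finset.sum_biUnion fun m _ n _ h => (σ.disjoint_block h).mono Finset.inter_subset_right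
    Finset.inter_subset_right]
  exact Finset.sum_le_sum_of_subset_of_nonneg
    (Finset.biUnion_subset.2 fun n _ => Finset.inter_subset_left) fun j _ _ => hx j

theorem sum_card_inter_block_le (A R : Finset ℕ) :
    ∑ n ∈ R, ((A ∩ σ.block n).card : ℝ) ≤ A.card := by
  simpa using σ.sum_sum_inter_block_le A R (x := fun _ => 1) fun _ => zero_le_one

variable {𝕜 : Type*} [RCLike 𝕜]

theorem seqRestrict_initial_apply {j n : ℕ} (hj : j ∈ σ.block n) (N : ℕ) (f : ℕ →₀ 𝕜) :
    seqRestrict (σ.initial N) f j = if n < N then f j else 0 := by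
  simp only [seqRestrict_apply, mem_initial, σ.index_eq hj]

theorem averaging_apply (f : ℕ →₀ 𝕜) (k : ℕ) :
    σ.averaging f k = seqAverage f (σ.block (σ.index k)) := rfl

theorem coAveraging_add_averaging (f : ℕ →₀ 𝕜) : σ.coAveraging f + σ.averaging f = f := by
  simp [coAveraging]

end OrderedPartition

section DKK

variable {𝕜 X S : Type*} [RCLike 𝕜] [NormedAddCommGroup X] [NormedSpace 𝕜 X]
  [NormedAddCommGroup S] [NormedSpace 𝕜 S]
  (B : SchauderBasis 𝕜 X) (E : SubsymmetricSequenceSpace 𝕜 S) (σ : OrderedPartition)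

theorem fund_block_pos (n : ℕ) : 0 < E.fund (σ.block n).card := E.fund_pos (σ.one_le_card_block n)

theorem card_block_pos (n : ℕ) : (0 : ℝ) < (σ.block n).card := by
  exact_mod_cast σ.one_le_card_block n

theorem dkkFunctional_add (n : ℕ) (f g : ℕ →₀ 𝕜) :
    dkkFunctional E σ n (f + g) = dkkFunctional E σ n f + dkkFunctional E σ n g := by
  simp [dkkFunctional, Finset.sum_add_distrib, mul_add]

theorem norm_dkkFunctional (n : ℕ) (f : ℕ →₀ 𝕜) :
    ‖dkkFunctional E σ n f‖ =
      E.fund (σ.block n).card / (σ.block n).card * ‖∑ j ∈ σ.block n, f j‖ := by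
  rw [dkkFunctional, norm_mul, norm_inv, RCLike.norm_ofReal, SubsymmetricSequenceSpace.dualFund,
    abs_of_nonneg (div_nonneg (Nat.cast_nonneg _) (E.fund_nonneg _)), inv_div]

theorem dkkFunctional_eq_zero {f : ℕ →₀ 𝕜} {A : Finset ℕ} (hA : f.support ⊆ A) {n : ℕ}
    (hn : n ∉ A.image σ.index) : dkkFunctional E σ n f = 0 := by
  rw [dkkFunctional, σ.sum_block_eq_zero f fun h => hn (Finset.image_subset_image hA h), mul_zero]

theorem averaging_apply_eq (f : ℕ →₀ 𝕜) (k : ℕ) :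
    σ.averaging f k = ((E.fund (σ.block (σ.index k)).card : ℝ) : 𝕜)⁻¹ *
      dkkFunctional E σ (σ.index k) f := by
  have h1 : ((E.fund (σ.block (σ.index k)).card : ℝ) : 𝕜) ≠ 0 := by
    exact_mod_cast (fund_block_pos E σ _).ne'
  rw [OrderedPartition.averaging_apply, seqAverage, dkkFunctional,
    SubsymmetricSequenceSpace.dualFund, RCLike.ofReal_div, inv_div, RCLike.ofReal_natCast,
    ← mul_assoc, ← mul_div_assoc, inv_mul_cancel₀ h1, one_div]

/-- `S_A P_σ f` as a combination of indicators of subsets of blocks. -/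
theorem seqRestrict_averaging_eq_sum (f : ℕ →₀ 𝕜) {A R : Finset ℕ} (hR : A.image σ.index ⊆ R) :
    seqRestrict A (σ.averaging f) = ∑ n ∈ R, (((E.fund (σ.block n).card : ℝ) : 𝕜)⁻¹ *
      dkkFunctional E σ n f) • seqOnes 𝕜 (A ∩ σ.block n) := by
  ext k
  rw [seqRestrict_apply, Finsupp.finsetSum_apply]
  simp only [Finsupp.smul_apply, seqOnes_apply, Finset.mem_inter, σ.mem_block_iff]
  split_ifs with hk
  · rw [Finset.sum_eq_single (σ.index k)]
    · simp [hk, averaging_apply_eq E]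
    · intro n _ hn
      simp [hn.symm]
    · intro h
      exact absurd (hR (Finset.mem_image_of_mem _ hk)) h
  · simp [hk]

theorem norm_ofFinsupp_seqRestrict_averaging_le (f : ℕ →₀ 𝕜) {A R : Finset ℕ}
    (hR : A.image σ.index ⊆ R) :
    ‖E.ofFinsupp (seqRestrict A (σ.averaging f))‖ ≤ ∑ n ∈ R, ‖dkkFunctional E σ n f‖ *
      (E.fund (A ∩ σ.block n).card / E.fund (σ.block n).card) := by
  rw [seqRestrict_averaging_eq_sum E σ f hR, map_sum]
  refine (norm_sum_le _ _).trans (Finset.sum_le_sum fun n _ => le_of_eq ?_)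
  rw [map_smul, norm_smul, E.norm_ofFinsupp_seqOnes, norm_mul, norm_inv, RCLike.norm_ofReal,
    abs_of_nonneg (E.fund_nonneg _)]
  ring

theorem norm_ofFinsupp_averaging_le {f : ℕ →₀ 𝕜} {A : Finset ℕ} (hA : f.support ⊆ A) :
    ‖E.ofFinsupp (σ.averaging f)‖ ≤ ∑ n ∈ A.image σ.index, ‖dkkFunctional E σ n f‖ := by
  have h : σ.averaging f = seqRestrict ((A.image σ.index).biUnion σ.block) (σ.averaging f) := by
    ext k
    rw [seqRestrict_apply]
    split_ifs with hk
    · rfl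
    · rw [averaging_apply_eq E, dkkFunctional_eq_zero E σ hA, mul_zero]
      exact fun h => hk (Finset.mem_biUnion.2 ⟨_, h, σ.mem_block_index k⟩)
  rw [h]
  refine (norm_ofFinsupp_seqRestrict_averaging_le E σ f (R := A.image σ.index) ?_).trans
    (Finset.sum_le_sum fun n _ => ?_)
  · intro n hn
    obtain ⟨j, hj, rfl⟩ := Finset.mem_image.1 hn
    obtain ⟨m, hm, hjm⟩ := Finset.mem_biUnion.1 hj
    rwa [σ.index_eq hjm]
  · refine mul_le_of_le_one_right (norm_nonneg _)
      (div_le_one_of_le₀ (E.fund_mono (Finset.card_le_card Finset.inter_subset_right))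
        (E.fund_nonneg _))

theorem norm_dkkFunctional_le_two_mul (n : ℕ) (f : ℕ →₀ 𝕜) :
    ‖dkkFunctional E σ n f‖ ≤ 2 * ‖E.ofFinsupp f‖ := by
  rw [norm_dkkFunctional, div_mul_eq_mul_div, div_le_iff₀ (card_block_pos σ n)]
  linarith [E.fund_mul_norm_sum_le (σ.block n) f]

theorem dkkFunctional_seqRestrict_initial (N n : ℕ) (f : ℕ →₀ 𝕜) :
    dkkFunctional E σ n (seqRestrict (σ.initial N) f) =
      if n < N then dkkFunctional E σ n f else 0 := by
  rw [dkkFunctional, Finset.sum_congr rfl fun j hj => σ.seqRestrict_initial_apply hj N f]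
  split_ifs <;> simp [dkkFunctional]

theorem coAveraging_seqRestrict_initial (N : ℕ) (f : ℕ →₀ 𝕜) :
    σ.coAveraging (seqRestrict (σ.initial N) f) = seqRestrict (σ.initial N) (σ.coAveraging f) := by
  ext k
  rw [σ.seqRestrict_initial_apply (σ.mem_block_index k)]
  simp only [OrderedPartition.coAveraging, LinearMap.sub_apply, LinearMap.id_apply,
    Finsupp.sub_apply, OrderedPartition.averaging_apply, seqAverage]
  rw [σ.seqRestrict_initial_apply (σ.mem_block_index k),
    Finset.sum_congr rfl fun j hj => σ.seqRestrict_initial_apply hj N f]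
  split_ifs <;> simp

theorem dkkSynthesis_eq_sum {f : ℕ →₀ 𝕜} {R : Finset ℕ}
    (hR : ∀ n ∉ R, dkkFunctional E σ n f = 0) :
    dkkSynthesis B E σ f = ∑ n ∈ R, dkkFunctional E σ n f • B n := by
  refine finsum_eq_sum_of_support_subset _ fun n hn => ?_
  by_contra h
  exact hn (by simp only [hR n h, zero_smul])

theorem coord_dkkSynthesis (f : ℕ →₀ 𝕜) (n : ℕ) :
    B.coord n (dkkSynthesis B E σ f) = dkkFunctional E σ n f := by
  classical
  rw [dkkSynthesis_eq_sum B E σ (R := insert n (f.support.image σ.index)) fun m hm =>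
    dkkFunctional_eq_zero E σ le_rfl fun h => hm (Finset.mem_insert_of_mem h)]
  simp [map_sum, B.ortho, Pi.single_apply]

theorem dkkSynthesis_seqRestrict_initial (N : ℕ) (f : ℕ →₀ 𝕜) :
    dkkSynthesis B E σ (seqRestrict (σ.initial N) f) =
      SchauderBasis.proj B N (dkkSynthesis B E σ f) := by
  rw [SchauderBasis.proj_apply, dkkSynthesis_eq_sum B E σ (R := Finset.range N)]
  · refine Finset.sum_congr rfl fun n hn => ?_
    rw [coord_dkkSynthesis, dkkFunctional_seqRestrict_initial, if_pos (Finset.mem_range.1 hn)]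
  · intro n hn
    rw [dkkFunctional_seqRestrict_initial, if_neg fun h => hn (Finset.mem_range.2 h)]

/-! ### Estimates for the norm of the Dilworth–Kalton–Kutzarova space on `c₀₀` -/

/-- The norm `‖f‖_{B,S,σ}` of a finitely supported sequence. -/
def dkkNorm (f : ℕ →₀ 𝕜) : ℝ := ‖E.ofFinsupp (σ.coAveraging f)‖ + ‖dkkSynthesis B E σ f‖

theorem dkkNorm_nonneg (f : ℕ →₀ 𝕜) : 0 ≤ dkkNorm B E σ f :=
  add_nonneg (norm_nonneg _) (norm_nonneg _)

theorem norm_ofFinsupp_coAveraging_le (f : ℕ →₀ 𝕜) :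
    ‖E.ofFinsupp (σ.coAveraging f)‖ ≤ dkkNorm B E σ f :=
  le_add_of_nonneg_right (norm_nonneg _)

theorem norm_dkkSynthesis_le (f : ℕ →₀ 𝕜) : ‖dkkSynthesis B E σ f‖ ≤ dkkNorm B E σ f :=
  le_add_of_nonneg_left (norm_nonneg _)

theorem dkkNorm_eq_norm_of (f : ℕ →₀ 𝕜) : dkkNorm B E σ f = ‖DKKPreSpace.of B E σ f‖ := rfl

theorem dkkNorm_add_le (f g : ℕ →₀ 𝕜) :
    dkkNorm B E σ (f + g) ≤ dkkNorm B E σ f + dkkNorm B E σ g := by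
  simp only [dkkNorm_eq_norm_of, map_add]
  exact norm_add_le _ _

theorem dkkNorm_sub_le (f g : ℕ →₀ 𝕜) :
    dkkNorm B E σ (f - g) ≤ dkkNorm B E σ f + dkkNorm B E σ g := by
  simp only [dkkNorm_eq_norm_of, map_sub]
  exact norm_sub_le _ _

variable {B E σ}

/-- The functionals `v_n^*` are uniformly bounded on `Y`, because the basis of `X` is
semi-normalized and `v_n^*(f)` is the `n`-th coordinate of `∑_n v_n^*(f) x_n`. -/
theorem exists_norm_dkkFunctional_le [CompleteSpace X] (hB : B.IsSemiNormalized) :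
    ∃ C : ℝ, 0 ≤ C ∧ ∀ (f : ℕ →₀ 𝕜) (n : ℕ),
      ‖dkkFunctional E σ n f‖ ≤ C * dkkNorm B E σ f := by
  obtain ⟨c, _, hc, hB⟩ := hB
  obtain ⟨K, hK⟩ := SchauderBasis.exists_norm_proj_le B
  have hK0 : 0 ≤ K := (norm_nonneg _).trans (hK 0)
  refine ⟨2 * K / c, by positivity, fun f n => ?_⟩
  set v := dkkSynthesis B E σ f with hv
  have h1 : dkkFunctional E σ n f • B n = SchauderBasis.proj B (n + 1) v -
      SchauderBasis.proj B n v := by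
    rw [SchauderBasis.proj_apply, SchauderBasis.proj_apply, Finset.sum_range_succ,
      add_sub_cancel_left, hv, coord_dkkSynthesis]
  have h2 : ‖dkkFunctional E σ n f‖ * ‖B n‖ ≤ K * ‖v‖ + K * ‖v‖ := by
    rw [← norm_smul, h1]
    exact (norm_sub_le _ _).trans (add_le_add
      (ContinuousLinearMap.le_of_opNorm_le _ (hK _) _)
      (ContinuousLinearMap.le_of_opNorm_le _ (hK _) _))
  have h3 : ‖dkkFunctional E σ n f‖ * c ≤ 2 * K * dkkNorm B E σ f := by
    have h4 := mul_le_mul_of_nonneg_left (hB n).1 (norm_nonneg (dkkFunctional E σ n f))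
    have h5 := mul_le_mul_of_nonneg_left (norm_dkkSynthesis_le B E σ f) hK0
    linarith
  rw [div_mul_eq_mul_div, le_div_iff₀ hc]
  exact h3

variable (E σ) in
/-- The norm of `Y` is controlled by the norm of `S` and the block functionals alone, since
`P_σ f` is the sum of the vectors `v_n^*(f) v_n`, where `v_n` is the normalized indicator of the
`n`-th block. -/
theorem exists_dkkNorm_le (hB : B.IsSemiNormalized) :
    ∃ C : ℝ, 0 ≤ C ∧ ∀ (f : ℕ →₀ 𝕜) (A : Finset ℕ), f.support ⊆ A →
      dkkNorm B E σ f ≤ ‖E.ofFinsupp f‖ +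
        C * ∑ n ∈ A.image σ.index, ‖dkkFunctional E σ n f‖ := by
  obtain ⟨c, b, hc, hB⟩ := hB
  have hb : 0 ≤ b := hc.le.trans ((hB 0).1.trans (hB 0).2)
  refine ⟨1 + b, by positivity, fun f A hA => ?_⟩
  have h1 : ‖E.ofFinsupp (σ.coAveraging f)‖ ≤ ‖E.ofFinsupp f‖ +
      ∑ n ∈ A.image σ.index, ‖dkkFunctional E σ n f‖ := by
    rw [OrderedPartition.coAveraging, LinearMap.sub_apply, LinearMap.id_apply, map_sub]
    exact (norm_sub_le _ _).trans (add_le_add le_rfl (norm_ofFinsupp_averaging_le E σ hA))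
  have h2 : ‖dkkSynthesis B E σ f‖ ≤ b * ∑ n ∈ A.image σ.index, ‖dkkFunctional E σ n f‖ := by
    rw [dkkSynthesis_eq_sum B E σ fun n hn => dkkFunctional_eq_zero E σ hA hn, Finset.mul_sum]
    refine (norm_sum_le _ _).trans (Finset.sum_le_sum fun n _ => ?_)
    rw [norm_smul, mul_comm]
    exact mul_le_mul_of_nonneg_right (hB n).2 (norm_nonneg _)
  rw [dkkNorm]
  linarith

/-- The upper democracy estimate. Blocks with at most `|A|` elements are treated with the lower
regularity property, and the other blocks with the almost monotonicity of `Λ_m / m`. -/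
theorem exists_dkkNorm_le_of_bound (hB : B.IsSemiNormalized) (hσ : σ.LacunaryGrowth)
    (hE : HasLRP E.fund) :
    ∃ C : ℝ, 0 ≤ C ∧ ∀ (f : ℕ →₀ 𝕜) (A : Finset ℕ) (s : ℝ), 0 ≤ s → f.support ⊆ A →
      (∀ j ∈ A, ‖f j‖ ≤ s) → dkkNorm B E σ f ≤ C * (s * E.fund A.card) := by
  obtain ⟨C₁, hC₁, h₁⟩ := exists_dkkNorm_le E σ hB
  obtain ⟨C₂, hC₂, h₂⟩ := E.exists_sum_fund_block_le hσ hE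
  refine ⟨2 + C₁ * (C₂ + 2), by positivity, fun f A s hs hA hf => ?_⟩
  have hsum : ∀ n, ‖∑ j ∈ σ.block n, f j‖ ≤ (A ∩ σ.block n).card * s := by
    intro n
    have e : ∑ j ∈ σ.block n, f j = ∑ j ∈ A ∩ σ.block n, f j := by
      refine (Finset.sum_subset Finset.inter_subset_right fun j hj hj' => ?_).symm
      by_contra h0
      exact hj' (Finset.mem_inter.2 ⟨hA (Finsupp.mem_support_iff.2 h0), hj⟩)
    rw [e]
    refine (norm_sum_le_of_le _ fun j hj => hf j (Finset.mem_inter.1 hj).1).trans ?_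
    rw [Finset.sum_const, nsmul_eq_mul]
  have hΛ := E.fund_nonneg A.card
  have small : ∑ n ∈ (A.image σ.index).filter (fun n => (σ.block n).card ≤ A.card),
      ‖dkkFunctional E σ n f‖ ≤ C₂ * (s * E.fund A.card) := by
    calc _ ≤ ∑ n ∈ (A.image σ.index).filter (fun n => (σ.block n).card ≤ A.card),
          s * E.fund (σ.block n).card := Finset.sum_le_sum fun n _ => by
            rw [norm_dkkFunctional, div_mul_eq_mul_div, div_le_iff₀ (card_block_pos σ n)]
            have h3 : ((A ∩ σ.block n).card : ℝ) ≤ (σ.block n).card := by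
              exact_mod_cast Finset.card_le_card Finset.inter_subset_right
            have h4 := (hsum n).trans (mul_le_mul_of_nonneg_right h3 hs)
            have h5 := mul_le_mul_of_nonneg_left h4 (fund_block_pos E σ n).le
            linarith
      _ ≤ s * (C₂ * E.fund A.card) := by
            rw [← Finset.mul_sum]
            exact mul_le_mul_of_nonneg_left (h₂ _ _ fun n hn => (Finset.mem_filter.1 hn).2) hs
      _ = _ := by ring
  have big : ∑ n ∈ (A.image σ.index).filter (fun n => ¬ (σ.block n).card ≤ A.card),
      ‖dkkFunctional E σ n f‖ ≤ 2 * (s * E.fund A.card) := by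
    rcases A.eq_empty_or_nonempty with rfl | hne
    · simp
    have hm : (0 : ℝ) < A.card := by exact_mod_cast Finset.card_pos.2 hne
    calc _ ≤ ∑ n ∈ (A.image σ.index).filter (fun n => ¬ (σ.block n).card ≤ A.card),
          2 * E.fund A.card / A.card * s * (A ∩ σ.block n).card :=
            Finset.sum_le_sum fun n hn => by
            have h3 := E.fund_mul_le_mul_fund (not_le.1 (Finset.mem_filter.1 hn).2).le
            have h4 : E.fund (σ.block n).card / (σ.block n).card ≤
                2 * E.fund A.card / A.card := by
              rw [div_le_div_iff₀ (card_block_pos σ n) hm]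
              linarith
            rw [norm_dkkFunctional]
            calc _ ≤ 2 * E.fund A.card / A.card * ((A ∩ σ.block n).card * s) :=
                  mul_le_mul h4 (hsum n) (norm_nonneg _) (by positivity)
              _ = _ := by ring
      _ ≤ 2 * E.fund A.card / A.card * s * A.card := by
            rw [← Finset.mul_sum]
            exact mul_le_mul_of_nonneg_left (σ.sum_card_inter_block_le _ _) (by positivity)
      _ = _ := by field_simp
  have h3 := h₁ f A hA
  rw [← Finset.sum_filter_add_sum_filter_not _ (fun n => (σ.block n).card ≤ A.card)] at h3
  have h4 := mul_le_mul_of_nonneg_left (add_le_add small big) hC₁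
  have h5 := E.norm_ofFinsupp_le_of_bound hs hA hf
  linarith

/-- The lower democracy estimate: if `|f| ≥ t` on `F`, then on part of `F` the sequence `Q_σ f` is
of size `t / 2`, and on the rest `P_σ f` is; the last block that meets the rest controls its size
by the lacunarity of the partition. -/
theorem exists_mul_fund_le_dkkNorm [CompleteSpace X] (hB : B.IsSemiNormalized)
    (hσ : σ.LacunaryGrowth) :
    ∃ C : ℝ, 0 ≤ C ∧ ∀ (f : ℕ →₀ 𝕜) (F : Finset ℕ) (t : ℝ), 0 ≤ t → (∀ k ∈ F, t ≤ ‖f k‖) →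
      t * E.fund F.card ≤ C * dkkNorm B E σ f := by
  obtain ⟨C₁, hC₁, h₁⟩ := exists_norm_dkkFunctional_le (E := E) (σ := σ) hB
  obtain ⟨K, _, hK⟩ := hσ.exists_partialCard_le
  refine ⟨4 + 2 * K * C₁, by positivity, fun f F t ht hf => ?_⟩
  set F₁ := F.filter fun k => t / 2 ≤ ‖σ.coAveraging f k‖ with hF₁
  set F₂ := F.filter fun k => ¬ t / 2 ≤ ‖σ.coAveraging f k‖ with hF₂
  have hcard : F.card = F₁.card + F₂.card :=
    (Finset.card_filter_add_card_filter_not _).symm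
  have hF1 : t / 2 * E.fund F₁.card ≤ 2 * dkkNorm B E σ f :=
    (E.mul_fund_le_of_le_norm (by positivity) fun j hj => (Finset.mem_filter.1 hj).2).trans
      (mul_le_mul_of_nonneg_left (norm_ofFinsupp_coAveraging_le B E σ f) zero_le_two)
  have hF2 : t * E.fund F₂.card ≤ 2 * K * C₁ * dkkNorm B E σ f := by
    rcases F₂.eq_empty_or_nonempty with h0 | hne
    · rw [h0, Finset.card_empty, E.fund_zero, mul_zero]
      exact mul_nonneg (by positivity) (dkkNorm_nonneg B E σ f)
    obtain ⟨k, hk, hmax⟩ := F₂.exists_max_image σ.index hne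
    set N := σ.index k with hN
    have hsub : F₂ ⊆ σ.initial (N + 1) := fun j hj =>
      σ.mem_initial.2 (Nat.lt_succ_of_le (hmax j hj))
    have h2 : E.fund F₂.card ≤ K * E.fund (σ.block N).card := by
      refine (E.fund_mono ?_).trans (E.fund_mul_le K _)
      exact ((Finset.card_le_card hsub).trans (σ.card_initial _).le).trans (hK N)
    have h3 : t / 2 ≤ ‖σ.averaging f k‖ := by
      have h4 := hf k (Finset.mem_filter.1 hk).1
      have h5 := not_le.1 (Finset.mem_filter.1 hk).2
      rw [← σ.coAveraging_add_averaging f, Finsupp.add_apply] at h4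
      have h6 := norm_add_le (σ.coAveraging f k) (σ.averaging f k)
      linarith
    rw [averaging_apply_eq E, norm_mul, norm_inv, RCLike.norm_ofReal,
      abs_of_nonneg (E.fund_nonneg _), ← hN, inv_mul_eq_div, le_div_iff₀ (fund_block_pos E σ N)]
      at h3
    have h4 := mul_le_mul_of_nonneg_left h2 ht
    have h5 := mul_le_mul_of_nonneg_left (h3.trans (h₁ f N)) (Nat.cast_nonneg (α := ℝ) K)
    linarith
  have h2 := mul_le_mul_of_nonneg_left (E.fund_add_le F₁.card F₂.card) ht
  rw [← hcard] at h2
  linarith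

theorem exists_dkkNorm_seqRestrict_initial_le [CompleteSpace X] :
    ∃ C : ℝ, 0 ≤ C ∧ ∀ (f : ℕ →₀ 𝕜) (N : ℕ),
      dkkNorm B E σ (seqRestrict (σ.initial N) f) ≤ C * dkkNorm B E σ f := by
  obtain ⟨K, hK⟩ := SchauderBasis.exists_norm_proj_le B
  have hK0 : 0 ≤ K := (norm_nonneg _).trans (hK 0)
  refine ⟨1 + K, by positivity, fun f N => ?_⟩
  have h1 := (E.norm_ofFinsupp_seqRestrict_le (σ.initial N) (σ.coAveraging f)).trans
    (norm_ofFinsupp_coAveraging_le B E σ f)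
  have h2 := (ContinuousLinearMap.le_of_opNorm_le _ (hK N) (dkkSynthesis B E σ f)).trans
    (mul_le_mul_of_nonneg_left (norm_dkkSynthesis_le B E σ f) hK0)
  rw [dkkNorm, coAveraging_seqRestrict_initial, dkkSynthesis_seqRestrict_initial]
  linarith

/-- Inside a single block the norm of `Y` is dominated by the norm of `S`. -/
theorem exists_dkkNorm_seqRestrict_block_le [CompleteSpace X] (hB : B.IsSemiNormalized) :
    ∃ C : ℝ, 0 ≤ C ∧ ∀ (f : ℕ →₀ 𝕜) (n : ℕ) (A : Finset ℕ), A ⊆ σ.block n →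
      dkkNorm B E σ (seqRestrict A f) ≤ C * dkkNorm B E σ f := by
  obtain ⟨C₁, hC₁, h₁⟩ := exists_norm_dkkFunctional_le (E := E) (σ := σ) hB
  obtain ⟨C₂, hC₂, h₂⟩ := exists_dkkNorm_le E σ hB
  refine ⟨(1 + C₂ * 2) * (1 + C₁), by positivity, fun f n A hA => ?_⟩
  have himg : A.image σ.index ⊆ {n} := fun m hm => by
    obtain ⟨j, hj, rfl⟩ := Finset.mem_image.1 hm
    exact Finset.mem_singleton.2 (σ.index_eq (hA hj))
  have h3 : ‖E.ofFinsupp (seqRestrict A f)‖ ≤ (1 + C₁) * dkkNorm B E σ f := by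
    have h4 := norm_ofFinsupp_seqRestrict_averaging_le E σ f himg
    rw [Finset.sum_singleton] at h4
    have h5 := mul_le_of_le_one_right (norm_nonneg (dkkFunctional E σ n f))
      (div_le_one_of_le₀ (E.fund_mono (Finset.card_le_card
        (Finset.inter_subset_right (s₁ := A) (s₂ := σ.block n)))) (E.fund_nonneg _))
    have h6 := (E.norm_ofFinsupp_seqRestrict_le A (σ.coAveraging f)).trans
      (norm_ofFinsupp_coAveraging_le B E σ f)
    have h7 := h₁ f n
    conv_lhs => rw [← σ.coAveraging_add_averaging f, map_add, map_add]
    have h8 := norm_add_le (E.ofFinsupp (seqRestrict A (σ.coAveraging f)))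
      (E.ofFinsupp (seqRestrict A (σ.averaging f)))
    linarith
  have h4 : ∑ m ∈ A.image σ.index, ‖dkkFunctional E σ m (seqRestrict A f)‖ ≤
      2 * ‖E.ofFinsupp (seqRestrict A f)‖ := by
    refine (Finset.sum_le_sum_of_subset_of_nonneg himg fun _ _ _ => norm_nonneg _).trans ?_
    rw [Finset.sum_singleton]
    exact norm_dkkFunctional_le_two_mul E σ n _
  calc dkkNorm B E σ (seqRestrict A f)
      ≤ ‖E.ofFinsupp (seqRestrict A f)‖ + C₂ * (2 * ‖E.ofFinsupp (seqRestrict A f)‖) :=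
        (h₂ _ A (seqRestrict_support_subset A f)).trans
          (add_le_add le_rfl (mul_le_mul_of_nonneg_left h4 hC₂))
    _ = (1 + C₂ * 2) * ‖E.ofFinsupp (seqRestrict A f)‖ := by ring
    _ ≤ (1 + C₂ * 2) * ((1 + C₁) * dkkNorm B E σ f) := by gcongr
    _ = _ := by ring

/-- The partial sum projections of the unit-vector system are uniformly bounded. -/
theorem exists_dkkNorm_seqRestrict_range_le [CompleteSpace X] (hB : B.IsSemiNormalized) :
    ∃ C : ℝ, 0 ≤ C ∧ ∀ (f : ℕ →₀ 𝕜) (k : ℕ),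
      dkkNorm B E σ (seqRestrict (Finset.range k) f) ≤ C * dkkNorm B E σ f := by
  obtain ⟨C₁, hC₁, h₁⟩ := exists_dkkNorm_seqRestrict_initial_le (B := B) (E := E) (σ := σ)
  obtain ⟨C₂, hC₂, h₂⟩ := exists_dkkNorm_seqRestrict_block_le (E := E) (σ := σ) hB
  refine ⟨C₁ + C₂, by positivity, fun f k => ?_⟩
  have h3 : seqRestrict (Finset.range k) f = seqRestrict (σ.initial (σ.index k)) f +
      seqRestrict (σ.block (σ.index k) ∩ Finset.range k) f := by
    ext j
    simp only [Finsupp.add_apply, seqRestrict_apply, Finset.mem_range, Finset.mem_inter,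
      σ.mem_initial, σ.mem_block_iff]
    rcases lt_or_ge j k with hj | hj
    · rcases (σ.index_mono hj.le).lt_or_eq with h | h
      · simp [hj, h, h.ne]
      · simp [hj, h]
    · simp [not_lt.2 hj, not_lt.2 (σ.index_mono hj)]
  rw [h3, add_mul]
  exact (dkkNorm_add_le B E σ _ _).trans
    (add_le_add (h₁ f _) (h₂ f _ _ Finset.inter_subset_left))

/-- The contribution of large blocks: this is where the upper regularity property or the
structure of `ℓ₁` enters. -/
theorem exists_sum_norm_dkkFunctional_seqRestrict_le (hσ : σ.LacunaryGrowth)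
    (hE : E.IsEllOne ∨ HasURP E.fund) :
    ∃ C : ℝ, 0 ≤ C ∧ ∀ (g : ℕ →₀ 𝕜) (F : Finset ℕ) (N : ℕ) (R : Finset ℕ),
      F.card ≤ σ.partialCard (N + 1) → (∀ n ∈ R, N ≤ n) →
      ∑ n ∈ R, ‖dkkFunctional E σ n (seqRestrict F g)‖ ≤ C * ‖E.ofFinsupp g‖ := by
  have hpt : ∀ (g : ℕ →₀ 𝕜) (F : Finset ℕ) (n : ℕ), ‖dkkFunctional E σ n (seqRestrict F g)‖ ≤
      E.fund (σ.block n).card / (σ.block n).card * ∑ j ∈ F ∩ σ.block n, ‖g j‖ := by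
    intro g F n
    rw [norm_dkkFunctional, sum_seqRestrict]
    exact mul_le_mul_of_nonneg_left (norm_sum_le _ _)
      (div_nonneg (E.fund_nonneg _) (Nat.cast_nonneg _))
  rcases hE with hE | hE
  · refine ⟨1, zero_le_one, fun g F N R _ _ => ?_⟩
    calc _ ≤ ∑ n ∈ R, ∑ j ∈ F ∩ σ.block n, ‖g j‖ := Finset.sum_le_sum fun n _ => by
            refine (hpt g F n).trans (le_of_eq ?_)
            rw [hE.fund_eq, div_self (card_block_pos σ n).ne', one_mul]
      _ ≤ ∑ j ∈ F, ‖g j‖ := σ.sum_sum_inter_block_le F R fun _ => norm_nonneg _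
      _ = ‖E.ofFinsupp (seqRestrict F g)‖ := by
            rw [hE.norm_ofFinsupp (seqRestrict_support_subset F g)]
            exact Finset.sum_congr rfl fun j hj => by rw [seqRestrict_apply, if_pos hj]
      _ ≤ 1 * ‖E.ofFinsupp g‖ := by
            rw [one_mul]
            exact E.norm_ofFinsupp_seqRestrict_le F g
  · obtain ⟨C, hC, h⟩ := E.exists_sum_fund_block_div_card_le hσ hE
    refine ⟨C * 4, by positivity, fun g F N R hF hR => ?_⟩
    rcases F.eq_empty_or_nonempty with rfl | hne
    · refine (Finset.sum_le_sum fun n _ => hpt g ∅ n).trans ?_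
      simp only [Finset.empty_inter, Finset.sum_empty, mul_zero, Finset.sum_const_zero]
      positivity
    have hF1 : 1 ≤ F.card := Finset.card_pos.2 hne
    have hF0 : (0 : ℝ) < F.card := by exact_mod_cast hF1
    have hΛ := E.fund_pos hF1
    calc _ ≤ ∑ n ∈ R, E.fund (σ.block n).card / (σ.block n).card * ∑ j ∈ F, ‖g j‖ :=
            Finset.sum_le_sum fun n _ => (hpt g F n).trans (mul_le_mul_of_nonneg_left
              (Finset.sum_le_sum_of_subset_of_nonneg Finset.inter_subset_left
                fun _ _ _ => norm_nonneg _)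
              (div_nonneg (E.fund_nonneg _) (Nat.cast_nonneg _)))
      _ ≤ C * (E.fund F.card / F.card) * ∑ j ∈ F, ‖g j‖ := by
            rw [← Finset.sum_mul]
            exact mul_le_mul_of_nonneg_right (h _ N R hF1 hF hR)
              (Finset.sum_nonneg fun _ _ => norm_nonneg _)
      _ = C * (E.fund F.card * ∑ j ∈ F, ‖g j‖) / F.card := by ring
      _ ≤ C * (4 * F.card * ‖E.ofFinsupp g‖) / F.card := by
            have := E.fund_mul_sum_norm_le F g
            gcongr
      _ = _ := by field_simp

/-- Restrictions of `P_σ f` to sets with few elements in large blocks. -/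
theorem exists_seqRestrict_averaging_le [CompleteSpace X] (hB : B.IsSemiNormalized)
    (hσ : σ.LacunaryGrowth) (hE : HasLRP E.fund) :
    ∃ C : ℝ, 0 ≤ C ∧ ∀ (f : ℕ →₀ 𝕜) (A : Finset ℕ) (N : ℕ),
      A.card ≤ σ.partialCard (N + 1) → (∀ n ∈ A.image σ.index, N ≤ n) →
      ‖E.ofFinsupp (seqRestrict A (σ.averaging f))‖ ≤ C * dkkNorm B E σ f ∧
      ∑ n ∈ A.image σ.index, ‖dkkFunctional E σ n (seqRestrict A (σ.averaging f))‖ ≤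
        2 * (C * dkkNorm B E σ f) := by
  obtain ⟨C₁, hC₁, h₁⟩ := exists_norm_dkkFunctional_le (E := E) (σ := σ) hB
  obtain ⟨C₂, hC₂, h₂⟩ := E.exists_sum_fund_div_fund_block_le hσ hE
  refine ⟨C₁ * C₂, by positivity, fun f A N hA hN => ?_⟩
  have hY := dkkNorm_nonneg B E σ f
  have key : ∑ n ∈ A.image σ.index, ‖dkkFunctional E σ n f‖ *
      (E.fund (A ∩ σ.block n).card / E.fund (σ.block n).card) ≤ C₁ * C₂ * dkkNorm B E σ f := by
    calc _ ≤ ∑ n ∈ A.image σ.index, C₁ * dkkNorm B E σ f *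
          (E.fund A.card / E.fund (σ.block n).card) := Finset.sum_le_sum fun n _ =>
            mul_le_mul (h₁ f n) (div_le_div_of_nonneg_right
              (E.fund_mono (Finset.card_le_card Finset.inter_subset_left)) (E.fund_nonneg _))
              (div_nonneg (E.fund_nonneg _) (E.fund_nonneg _)) (by positivity)
      _ ≤ C₁ * dkkNorm B E σ f * C₂ := by
            rw [← Finset.mul_sum]
            exact mul_le_mul_of_nonneg_left (h₂ _ N _ hA hN) (by positivity)
      _ = _ := by ring
  refine ⟨(norm_ofFinsupp_seqRestrict_averaging_le E σ f le_rfl).trans key,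
    le_trans ?_ (mul_le_mul_of_nonneg_left key zero_le_two)⟩
  rw [Finset.mul_sum]
  refine Finset.sum_le_sum fun n _ => ?_
  have h3 : ∑ j ∈ σ.block n, seqRestrict A (σ.averaging f) j = ((A ∩ σ.block n).card : 𝕜) *
      (((E.fund (σ.block n).card : ℝ) : 𝕜)⁻¹ * dkkFunctional E σ n f) := by
    rw [sum_seqRestrict, Finset.sum_congr rfl fun j hj => by
      rw [averaging_apply_eq E, σ.index_eq (Finset.mem_inter.1 hj).2]]
    simp
  have hΛ := fund_block_pos E σ n
  have ha := card_block_pos σ n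
  rw [norm_dkkFunctional, h3, norm_mul, norm_mul, norm_inv, RCLike.norm_ofReal,
    abs_of_nonneg (E.fund_nonneg _), RCLike.norm_natCast]
  have h4 := E.fund_mul_le_mul_fund (Finset.card_le_card
    (Finset.inter_subset_right (s₁ := A) (s₂ := σ.block n)))
  have h5 : E.fund (σ.block n).card / (σ.block n).card * (A ∩ σ.block n).card ≤
      2 * E.fund (A ∩ σ.block n).card := by
    rw [div_mul_eq_mul_div, div_le_iff₀ ha]
    linarith
  calc _ = (E.fund (σ.block n).card / (σ.block n).card * (A ∩ σ.block n).card) *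
        ((E.fund (σ.block n).card)⁻¹ * ‖dkkFunctional E σ n f‖) := by ring
    _ ≤ 2 * E.fund (A ∩ σ.block n).card *
        ((E.fund (σ.block n).card)⁻¹ * ‖dkkFunctional E σ n f‖) :=
        mul_le_mul_of_nonneg_right h5 (by positivity)
    _ = _ := by ring

/-- The unit-vector system is quasi-greedy. The blocks are separated at the number of elements of
the greedy set `F`. On the union `I` of the small blocks `S_F f` is the difference of `S_I f` and
of `S_{I \ F} f`, a sequence with few and small entries; on the large blocks `Q_σ f` and `P_σ f`
are estimated separately. -/
theorem exists_dkkNorm_seqRestrict_greedy_le [CompleteSpace X] (hB : B.IsSemiNormalized)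
    (hσ : σ.LacunaryGrowth) (hL : HasLRP E.fund) (hE : E.IsEllOne ∨ HasURP E.fund) :
    ∃ C : ℝ, 0 ≤ C ∧ ∀ (f : ℕ →₀ 𝕜) (F : Finset ℕ) (t : ℝ), 0 ≤ t → (∀ k ∈ F, t ≤ ‖f k‖) →
      (∀ j ∉ F, ‖f j‖ ≤ t) → dkkNorm B E σ (seqRestrict F f) ≤ C * dkkNorm B E σ f := by
  obtain ⟨C₁, hC₁, h₁⟩ := exists_dkkNorm_seqRestrict_initial_le (B := B) (E := E) (σ := σ)
  obtain ⟨C₂, hC₂, h₂⟩ := exists_dkkNorm_le_of_bound hB hσ hL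
  obtain ⟨C₃, hC₃, h₃⟩ := exists_mul_fund_le_dkkNorm (E := E) hB hσ
  obtain ⟨C₄, hC₄, h₄⟩ := exists_dkkNorm_le E σ hB
  obtain ⟨C₅, hC₅, h₅⟩ := exists_sum_norm_dkkFunctional_seqRestrict_le hσ hE
  obtain ⟨C₆, hC₆, h₆⟩ := exists_seqRestrict_averaging_le hB hσ hL
  refine ⟨C₁ + C₂ * C₃ + (1 + C₆ + C₄ * (C₅ + 2 * C₆)), by positivity,
    fun f F t ht hF hFc => ?_⟩
  -- With `N` minimal, the first `N` blocks have at most `|F|` elements in total, while every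
  -- later block has at least a fixed proportion of `|F|` elements.
  have hex : ∃ N, F.card ≤ σ.partialCard (N + 1) :=
    ⟨F.card, (σ.le_partialCard _).trans (σ.partialCard_mono (Nat.le_succ _))⟩
  obtain ⟨N, hN, hNmin⟩ : ∃ N, F.card ≤ σ.partialCard (N + 1) ∧ σ.partialCard N ≤ F.card := by
    classical
    refine ⟨Nat.find hex, Nat.find_spec hex, ?_⟩
    rcases h : Nat.find hex with _ | n
    · simp [OrderedPartition.partialCard]
    · exact (not_le.1 (Nat.find_min hex (show n < Nat.find hex by omega))).le
  set I := σ.initial N with hI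
  have hsplit : seqRestrict F f =
      (seqRestrict I f - seqRestrict (I \ F) f) + seqRestrict (F \ I) f := by
    ext j
    simp only [Finsupp.add_apply, Finsupp.sub_apply, seqRestrict_apply, Finset.mem_sdiff]
    by_cases hjF : j ∈ F <;> by_cases hjI : j ∈ I <;> simp [hjF, hjI]
  have hsmall : dkkNorm B E σ (seqRestrict (I \ F) f) ≤ C₂ * (C₃ * dkkNorm B E σ f) := by
    refine (h₂ _ (I \ F) t ht (seqRestrict_support_subset _ _) fun j hj => ?_).trans
      (mul_le_mul_of_nonneg_left ?_ hC₂)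
    · rw [seqRestrict_apply, if_pos hj]
      exact hFc j (Finset.mem_sdiff.1 hj).2
    · refine le_trans (mul_le_mul_of_nonneg_left (E.fund_mono ?_) ht) (h₃ f F t ht hF)
      exact (Finset.card_le_card Finset.sdiff_subset).trans ((σ.card_initial N).le.trans hNmin)
  have hbig : dkkNorm B E σ (seqRestrict (F \ I) f) ≤
      (1 + C₆ + C₄ * (C₅ + 2 * C₆)) * dkkNorm B E σ f := by
    have hcard : (F \ I).card ≤ σ.partialCard (N + 1) :=
      (Finset.card_le_card Finset.sdiff_subset).trans hN
    have hidx : ∀ n ∈ (F \ I).image σ.index, N ≤ n := fun n hn => by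
      obtain ⟨j, hj, rfl⟩ := Finset.mem_image.1 hn
      exact not_lt.1 fun h => (Finset.mem_sdiff.1 hj).2 (σ.mem_initial.2 h)
    have hdec : seqRestrict (F \ I) f = seqRestrict (F \ I) (σ.coAveraging f) +
        seqRestrict (F \ I) (σ.averaging f) := by
      rw [← map_add, σ.coAveraging_add_averaging]
    obtain ⟨h6a, h6b⟩ := h₆ f (F \ I) N hcard hidx
    have hQ := norm_ofFinsupp_coAveraging_le B E σ f
    have hN1 : ‖E.ofFinsupp (seqRestrict (F \ I) f)‖ ≤ (1 + C₆) * dkkNorm B E σ f := by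
      rw [hdec, map_add]
      have h7 := norm_add_le (E.ofFinsupp (seqRestrict (F \ I) (σ.coAveraging f)))
        (E.ofFinsupp (seqRestrict (F \ I) (σ.averaging f)))
      have h8 := E.norm_ofFinsupp_seqRestrict_le (F \ I) (σ.coAveraging f)
      linarith
    have hD : ∑ n ∈ (F \ I).image σ.index, ‖dkkFunctional E σ n (seqRestrict (F \ I) f)‖ ≤
        (C₅ + 2 * C₆) * dkkNorm B E σ f := by
      have h7 := h₅ (σ.coAveraging f) (F \ I) N _ hcard hidx
      have h8 := mul_le_mul_of_nonneg_left hQ hC₅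
      have h9 : ∑ n ∈ (F \ I).image σ.index, ‖dkkFunctional E σ n (seqRestrict (F \ I) f)‖ ≤
          ∑ n ∈ (F \ I).image σ.index,
            ‖dkkFunctional E σ n (seqRestrict (F \ I) (σ.coAveraging f))‖ +
          ∑ n ∈ (F \ I).image σ.index,
            ‖dkkFunctional E σ n (seqRestrict (F \ I) (σ.averaging f))‖ := by
        rw [← Finset.sum_add_distrib]
        refine Finset.sum_le_sum fun n _ => ?_
        rw [hdec, dkkFunctional_add]
        exact norm_add_le _ _
      linarith
    have h7 := h₄ _ (F \ I) (seqRestrict_support_subset (F \ I) f)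
    have h8 := mul_le_mul_of_nonneg_left hD hC₄
    linarith
  rw [hsplit]
  have h7 := dkkNorm_add_le B E σ (seqRestrict I f - seqRestrict (I \ F) f) (seqRestrict (F \ I) f)
  have h8 := dkkNorm_sub_le B E σ (seqRestrict I f) (seqRestrict (I \ F) f)
  have h9 := h₁ f N
  linarith

/-- The almost greedy inequality on `c₀₀`, deduced from quasi-greediness and the two democracy
estimates. -/
theorem exists_dkkNorm_sub_greedy_le [CompleteSpace X] (hB : B.IsSemiNormalized)
    (hσ : σ.LacunaryGrowth) (hL : HasLRP E.fund) (hE : E.IsEllOne ∨ HasURP E.fund) :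
    ∃ C : ℝ, 0 ≤ C ∧ ∀ (f : ℕ →₀ 𝕜) (A F : Finset ℕ), A.card ≤ F.card →
      (∀ k ∈ F, ∀ j ∉ F, ‖f j‖ ≤ ‖f k‖) →
      dkkNorm B E σ (f - seqRestrict F f) ≤ C * dkkNorm B E σ (f - seqRestrict A f) := by
  obtain ⟨C₁, hC₁, h₁⟩ := exists_dkkNorm_seqRestrict_greedy_le hB hσ hL hE
  obtain ⟨C₂, hC₂, h₂⟩ := exists_dkkNorm_le_of_bound hB hσ hL
  obtain ⟨C₃, hC₃, h₃⟩ := exists_mul_fund_le_dkkNorm (E := E) hB hσ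
  refine ⟨1 + C₁ + C₂ * C₃, by positivity, fun f A F hcard hF => ?_⟩
  rcases F.eq_empty_or_nonempty with rfl | hne
  · obtain rfl : A = ∅ := Finset.card_eq_zero.1 (Nat.le_zero.1 hcard)
    exact le_mul_of_one_le_left (dkkNorm_nonneg B E σ _)
      (by linarith [mul_nonneg hC₂ hC₃])
  obtain ⟨k₀, hk₀, hmin⟩ := F.exists_min_image (fun k => ‖f k‖) hne
  set t := ‖f k₀‖ with ht
  have ht0 : 0 ≤ t := norm_nonneg _
  set g := f - seqRestrict A f with hg
  have hgk : ∀ k, g k = if k ∈ A then 0 else f k := fun k => by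
    rw [hg, Finsupp.sub_apply, seqRestrict_apply]
    split_ifs <;> simp
  have hsplit : f - seqRestrict F f =
      (g - seqRestrict (F \ A) g) + seqRestrict (A \ F) f := by
    ext j
    simp only [Finsupp.add_apply, Finsupp.sub_apply, seqRestrict_apply, Finset.mem_sdiff, hgk]
    by_cases hjF : j ∈ F <;> by_cases hjA : j ∈ A <;> simp [hjF, hjA]
  have hgF : ∀ k ∈ F \ A, t ≤ ‖g k‖ := fun k hk => by
    rw [Finset.mem_sdiff] at hk
    rw [hgk, if_neg hk.2]
    exact hmin k hk.1
  have h4 : dkkNorm B E σ (seqRestrict (F \ A) g) ≤ C₁ * dkkNorm B E σ g := by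
    refine h₁ g (F \ A) t ht0 hgF fun j hj => ?_
    rw [hgk]
    split_ifs with hjA
    · simpa using ht0
    · exact hF k₀ hk₀ j fun hjF => hj (Finset.mem_sdiff.2 ⟨hjF, hjA⟩)
  have h5 : dkkNorm B E σ (seqRestrict (A \ F) f) ≤ C₂ * (C₃ * dkkNorm B E σ g) := by
    refine (h₂ _ (A \ F) t ht0 (seqRestrict_support_subset _ _) fun j hj => ?_).trans
      (mul_le_mul_of_nonneg_left ?_ hC₂)
    · rw [seqRestrict_apply, if_pos hj]
      exact hF k₀ hk₀ j (Finset.mem_sdiff.1 hj).2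
    · refine le_trans (mul_le_mul_of_nonneg_left (E.fund_mono ?_) ht0) (h₃ g (F \ A) t ht0 hgF)
      exact Finset.card_sdiff_le_card_sdiff_iff.2 hcard
  rw [hsplit]
  have h6 := dkkNorm_add_le B E σ (g - seqRestrict (F \ A) g) (seqRestrict (A \ F) f)
  have h7 := dkkNorm_sub_le B E σ g (seqRestrict (F \ A) g)
  linarith

end DKK

/-! ### The unit-vector basis of the completion -/

theorem seqRestrict_eq_sum_single {𝕜 : Type*} [RCLike 𝕜] (A : Finset ℕ) (f : ℕ →₀ 𝕜) :
    seqRestrict A f = ∑ j ∈ A, Finsupp.single j (f j) := by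
  classical
  ext k
  simp [seqRestrict_apply, Finsupp.finsetSum_apply, Finsupp.single_apply]

section DKK

variable {𝕜 X S : Type*} [RCLike 𝕜] [NormedAddCommGroup X] [NormedSpace 𝕜 X]
  [NormedAddCommGroup S] [NormedSpace 𝕜 S]
  (B : SchauderBasis 𝕜 X) (E : SubsymmetricSequenceSpace 𝕜 S) (σ : OrderedPartition)

/-- The canonical map from `c₀₀` to its completion. -/
def DKKSpace.ofFinsupp : (ℕ →₀ 𝕜) →ₗ[𝕜] DKKSpace B E σ :=
  (UniformSpace.Completion.toComplL (𝕜 := 𝕜) (E := DKKPreSpace B E σ)).toLinearMap ∘ₗ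
    (DKKPreSpace.of B E σ).toLinearMap

theorem DKKSpace.norm_ofFinsupp (f : ℕ →₀ 𝕜) :
    ‖DKKSpace.ofFinsupp B E σ f‖ = dkkNorm B E σ f :=
  UniformSpace.Completion.norm_coe (DKKPreSpace.of B E σ f)

theorem DKKSpace.denseRange_ofFinsupp : DenseRange (DKKSpace.ofFinsupp B E σ) :=
  UniformSpace.Completion.denseRange_coe.comp (DKKPreSpace.of B E σ).surjective.denseRange
    (UniformSpace.Completion.continuous_coe _)

theorem DKKSpace.unitVector_eq (j : ℕ) :
    DKKSpace.unitVector B E σ j = DKKSpace.ofFinsupp B E σ (Finsupp.single j 1) := rfl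

theorem DKKSpace.ofFinsupp_single (j : ℕ) (a : 𝕜) :
    DKKSpace.ofFinsupp B E σ (Finsupp.single j a) = a • DKKSpace.unitVector B E σ j := by
  rw [DKKSpace.unitVector_eq, ← map_smul, Finsupp.smul_single, smul_eq_mul, mul_one]

variable {B E σ}

/-- The unit vectors form a Schauder basis of `Y[B, S, σ]`: the coordinates and the partial sums are
bounded on `c₀₀`, hence extend to the completion, where the partial sums converge to the identity
because they do so on the dense subspace `c₀₀`. -/
theorem DKKSpace.exists_schauderBasis [CompleteSpace X] (hB : B.IsSemiNormalized)
    (hσ : σ.LacunaryGrowth) :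
    ∃ U : SchauderBasis 𝕜 (DKKSpace B E σ), ∀ j, U j = DKKSpace.unitVector B E σ j := by
  obtain ⟨C₁, hC₁, h₁⟩ := exists_mul_fund_le_dkkNorm (E := E) hB hσ
  obtain ⟨C₂, hC₂, h₂⟩ := exists_dkkNorm_seqRestrict_range_le (E := E) (σ := σ) hB
  set ι := DKKSpace.ofFinsupp B E σ with hι
  have hdense : DenseRange ι := DKKSpace.denseRange_ofFinsupp B E σ
  have hcoord : ∀ j, ∃ C, ∀ f : ℕ →₀ 𝕜, ‖Finsupp.lapply (R := 𝕜) j f‖ ≤ C * ‖ι f‖ := by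
    intro j
    refine ⟨C₁ / E.fund 1, fun f => ?_⟩
    have h3 := h₁ f {j} ‖f j‖ (norm_nonneg _) fun k hk => by rw [Finset.mem_singleton.1 hk]
    rw [Finset.card_singleton] at h3
    rw [hι, DKKSpace.norm_ofFinsupp, div_mul_eq_mul_div, le_div_iff₀ (E.fund_pos le_rfl)]
    exact h3
  set coord : ℕ → StrongDual 𝕜 (DKKSpace B E σ) := fun j =>
    (Finsupp.lapply (R := 𝕜) j : (ℕ →₀ 𝕜) →ₗ[𝕜] 𝕜).extendOfNorm ι with hcoord_def
  have hc : ∀ f j, coord j (ι f) = f j := fun f j =>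
    LinearMap.extendOfNorm_eq hdense (hcoord j) f
  set P : ℕ → DKKSpace B E σ →L[𝕜] DKKSpace B E σ := fun n =>
    ∑ i ∈ Finset.range n, (coord i).smulRight (DKKSpace.unitVector B E σ i) with hP_def
  have hPa : ∀ n y, P n y =
      ∑ i ∈ Finset.range n, coord i y • DKKSpace.unitVector B E σ i := fun n y => by
    simp [hP_def]
  have hPι : ∀ n f, P n (ι f) = ι (seqRestrict (Finset.range n) f) := fun n f => by
    rw [hPa, seqRestrict_eq_sum_single, map_sum]
    exact Finset.sum_congr rfl fun i _ => by rw [hc, hι, DKKSpace.ofFinsupp_single]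
  have hPn : ∀ n y, ‖P n y‖ ≤ C₂ * ‖y‖ := fun n y => by
    refine hdense.induction_on (p := fun y => ‖P n y‖ ≤ C₂ * ‖y‖) y ?_ fun f => ?_
    · exact isClosed_le (by fun_prop) (by fun_prop)
    · rw [hPι, hι, DKKSpace.norm_ofFinsupp, DKKSpace.norm_ofFinsupp]
      exact h₂ f n
  have htend : ∀ y, Filter.Tendsto (fun n => P n y) Filter.atTop (nhds y) := by
    intro y
    rw [Metric.tendsto_atTop]
    intro ε hε
    -- The constant `C₂ + 2` bounds the norm of `P n - id` strictly.
    have hδ : 0 < ε / (C₂ + 2) := by positivity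
    obtain ⟨f, hf⟩ := hdense.exists_dist_lt y hδ
    obtain ⟨n₀, hn₀⟩ := f.support.exists_nat_subset_range
    refine ⟨n₀, fun n hn => ?_⟩
    have hfix : P n (ι f) = ι f := by
      rw [hPι]
      congr 1
      ext k
      rw [seqRestrict_apply]
      split_ifs with hk
      · rfl
      · by_contra h0
        exact hk (Finset.range_mono hn (hn₀ (Finsupp.mem_support_iff.2 (Ne.symm h0))))
    rw [dist_eq_norm] at hf ⊢
    have e : P n y - y = P n (y - ι f) - (y - ι f) := by
      rw [map_sub, hfix]
      abel
    rw [e]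
    have h3 := norm_sub_le (P n (y - ι f)) (y - ι f)
    have h4 := hPn n (y - ι f)
    have h5 : (C₂ + 2) * ‖y - ι f‖ < ε := by
      rw [lt_div_iff₀ (by positivity)] at hf
      linarith
    linarith [norm_nonneg (y - ι f)]
  refine ⟨⟨DKKSpace.unitVector B E σ, coord, fun i j => ?_, fun y => ?_⟩, fun j => rfl⟩
  · simp [DKKSpace.unitVector_eq, ← hι, hc, Finsupp.single_apply, Pi.single_apply, eq_comm]
  · rw [HasSum, SummationFilter.conditional_filter_eq_map_range, Filter.tendsto_map'_iff]
    refine (htend y).congr fun n => ?_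
    rw [hPa]
    rfl

/-- The partial sums of `f` agree with `f` on `A` and `F` and have `F` as a greedy set as soon as
they are long enough, so the almost greedy inequality passes from `c₀₀` to its completion. -/
theorem DKKSpace.isAlmostGreedy [CompleteSpace X] (hB : B.IsSemiNormalized)
    (hσ : σ.LacunaryGrowth) (hL : HasLRP E.fund) (hE : E.IsEllOne ∨ HasURP E.fund)
    {U : SchauderBasis 𝕜 (DKKSpace B E σ)} (hU : ∀ j, U j = DKKSpace.unitVector B E σ j) :
    U.IsAlmostGreedy := by
  classical
  obtain ⟨C, _, hC⟩ := exists_dkkNorm_sub_greedy_le hB hσ hL hE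
  refine ⟨C, fun y A F hcard hF => ?_⟩
  set f : ℕ → ℕ →₀ 𝕜 := fun n => ∑ i ∈ Finset.range n, Finsupp.single i (U.coord i y) with hf_def
  have hf : ∀ n k, f n k = if k < n then U.coord k y else 0 := fun n k => by
    simp [hf_def, Finsupp.finsetSum_apply, Finsupp.single_apply]
  have hfy : ∀ n, DKKSpace.ofFinsupp B E σ (f n) = SchauderBasis.proj U n y := fun n => by
    rw [SchauderBasis.proj_apply, hf_def, map_sum]
    exact Finset.sum_congr rfl fun i _ => by rw [DKKSpace.ofFinsupp_single, hU]
  have hlim : Filter.Tendsto (fun n => DKKSpace.ofFinsupp B E σ (f n)) Filter.atTop (nhds y) := by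
    simpa only [hfy] using SchauderBasis.tendsto_proj U y
  have hres : ∀ (G : Finset ℕ) (n : ℕ), G ⊆ Finset.range n →
      DKKSpace.ofFinsupp B E σ (seqRestrict G (f n)) = GeneralSchauderBasis.proj U G y := by
    intro G n hG
    rw [GeneralSchauderBasis.proj_apply, seqRestrict_eq_sum_single, map_sum]
    refine Finset.sum_congr rfl fun i hi => ?_
    rw [DKKSpace.ofFinsupp_single, hU, hf, if_pos (Finset.mem_range.1 (hG hi))]
  obtain ⟨n₁, hn₁⟩ := A.exists_nat_subset_range
  obtain ⟨n₂, hn₂⟩ := F.exists_nat_subset_range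
  refine le_of_tendsto_of_tendsto (hlim.sub_const _).norm ((hlim.sub_const _).norm.const_mul C) ?_
  filter_upwards [Filter.eventually_ge_atTop n₁, Filter.eventually_ge_atTop n₂] with n h1 h2
  have hA := hn₁.trans (Finset.range_mono h1)
  have hF' := hn₂.trans (Finset.range_mono h2)
  rw [← hres A n hA, ← hres F n hF', ← map_sub, ← map_sub, DKKSpace.norm_ofFinsupp,
    DKKSpace.norm_ofFinsupp]
  refine hC (f n) A F hcard fun k hk j hj => ?_
  rw [hf, hf, if_pos (Finset.mem_range.1 (hF' hk))]
  split_ifs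
  · exact hF k hk j hj
  · simp

theorem DKKSpace.sum_unitVector (A : Finset ℕ) :
    ∑ j ∈ A, DKKSpace.unitVector B E σ j = DKKSpace.ofFinsupp B E σ (seqOnes 𝕜 A) := by
  classical
  have h : seqOnes 𝕜 A = ∑ j ∈ A, Finsupp.single j 1 := by
    ext k
    simp [seqOnes_apply, Finsupp.finsetSum_apply, Finsupp.single_apply]
  rw [h, map_sum]
  rfl

end DKK

end

theorem theorem3p10 {𝕜 X S : Type*} [RCLike 𝕜]
    [NormedAddCommGroup X] [NormedSpace 𝕜 X] [CompleteSpace X]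
    [NormedAddCommGroup S] [NormedSpace 𝕜 S] [CompleteSpace S]
    (B : SchauderBasis 𝕜 X) (hB : B.IsSemiNormalized)
    (E : SubsymmetricSequenceSpace 𝕜 S) (σ : OrderedPartition)
    (hσ : σ.LacunaryGrowth)
    (hE : E.IsEllOne ∨ (HasLRP E.fund ∧ HasURP E.fund)) :
    ∃ U : SchauderBasis 𝕜 (DKKSpace B E σ),
      (∀ j, U j = DKKSpace.unitVector B E σ j) ∧
      U.IsSemiNormalized ∧
      U.IsAlmostGreedy ∧
      WeightEquiv U.fundamentalFunction E.fund := by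
  have hL : HasLRP E.fund := hE.elim (fun h => h.hasLRP) fun h => h.1
  have hE' : E.IsEllOne ∨ HasURP E.fund := hE.imp_right fun h => h.2
  obtain ⟨U, hU⟩ := DKKSpace.exists_schauderBasis (E := E) hB hσ
  obtain ⟨C₁, hC₁, h₁⟩ := exists_dkkNorm_le_of_bound hB hσ hL
  obtain ⟨C₂, hC₂, h₂⟩ := exists_mul_fund_le_dkkNorm (E := E) hB hσ
  have hnorm : ∀ A : Finset ℕ, ‖∑ j ∈ A, U j‖ = dkkNorm B E σ (seqOnes 𝕜 A) := fun A => by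
    rw [Finset.sum_congr rfl fun j _ => hU j, DKKSpace.sum_unitVector, DKKSpace.norm_ofFinsupp]
  have hupper : ∀ A : Finset ℕ, ‖∑ j ∈ A, U j‖ ≤ C₁ * E.fund A.card := fun A => by
    rw [hnorm]
    have := h₁ _ A 1 zero_le_one (seqOnes_support_subset A) fun j hj => by
      simp [seqOnes_apply, hj]
    rwa [one_mul] at this
  have hlower : ∀ A : Finset ℕ, E.fund A.card ≤ C₂ * ‖∑ j ∈ A, U j‖ := fun A => by
    rw [hnorm]
    have := h₂ (seqOnes 𝕜 A) A 1 zero_le_one fun j hj => by simp [seqOnes_apply, hj]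
    rwa [one_mul] at this
  have hC₂pos : 0 < C₂ := by
    have h3 := hlower {0}
    have h4 := E.fund_pos le_rfl
    rw [Finset.card_singleton] at h3
    refine hC₂.lt_of_ne fun h0 => ?_
    rw [← h0, zero_mul] at h3
    linarith
  have hbound : ∀ m (A : {A : Finset ℕ // A.card ≤ m}), ‖∑ j ∈ A.1, U j‖ ≤ C₁ * E.fund m :=
    fun m A => (hupper A.1).trans (mul_le_mul_of_nonneg_left (E.fund_mono A.2) hC₁)
  refine ⟨U, hU, ⟨E.fund 1 / C₂, C₁ * E.fund 1, div_pos (E.fund_pos le_rfl) hC₂pos, fun j => ?_⟩,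
    DKKSpace.isAlmostGreedy hB hσ hL hE' hU, ⟨C₁, fun m _ => ?_⟩, ⟨C₂, fun m _ => ?_⟩⟩
  · have h3 := hlower {j}
    have h4 := hupper {j}
    rw [Finset.card_singleton, Finset.sum_singleton] at h3 h4
    exact ⟨by rw [div_le_iff₀ hC₂pos]; linarith, h4⟩
  · have : Nonempty {A : Finset ℕ // A.card ≤ m} := ⟨⟨∅, by simp⟩⟩
    exact ciSup_le (hbound m)
  · have h3 := hlower (Finset.range m)
    rw [Finset.card_range] at h3
    refine h3.trans (mul_le_mul_of_nonneg_left ?_ hC₂)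
    exact le_ciSup (f := fun A : {A : Finset ℕ // A.card ≤ m} => ‖∑ j ∈ A.1, U j‖)
      ⟨C₁ * E.fund m, by rintro _ ⟨A, rfl⟩; exact hbound m A⟩
      ⟨Finset.range m, (Finset.card_range m).le⟩
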